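/- Let $L$ be a finite relational language, all of whose relation symbols have positive arity, containing a $3$-ary symbol. For a finite $L$-structure $A$ let $\delta(A)=|A|-\sum_{R\in L}|R[A]|$, where $R[A]$ is the set of tuples from $A$ satisfying $R$. For finite $A\subseteq B$ write $A\le B$ if $\delta(A)<\delta(B')$ whenever $A\subsetneq B'\subseteq B$; for an arbitrary $L$-structure $M$ and $A\subseteq M$ write $A\le M$ if $A\cap X\le X$ for all finite $X\subseteq M$. Let $f:[0,\infty)\to\mathbb{R}$ be continuous and increasing (not necessarily strictly) with $f(x)\to\infty$ as $x\to\infty$, and suppose that $f$ has a right derivative $f'(x)\le\frac{1}{2(x+1)}$ at every $x\ge 0$. Let $\mathcal{K}_f$ be the class of finite $L$-structures $A$ with $\emptyset\le A$ and $\delta(X)\ge f(|X|)$ for all $X\subseteq A$. Let $M_f$ be the generic structure of $(\mathcal{K}_f,\le)$, that is, an $L$-structure such that 1. $M_f$ is the union of a (countable) chain of finite substructures $S\le M_f$ with $S\in\mathcal{K}_f$; 2. whenever $A\le M_f$ is finite and $A\le B\in\mathcal{K}_f$, there is an embedding $\beta:B\to M_f$ with $\beta(B)\le M_f$ and $\beta(a)=a$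 for all $a\in A$. For a finite tuple $\bar a$ in $M_f$ let $d(\bar a)=\min\{\delta(Y):\bar a\subseteq Y\subseteq M_f,\ Y\text{ finite}\}$. For an $L$-formula $\Phi(\bar x)$ without parameters, in finitely many variables, let $d(\Phi)=\max\{d(\bar a):M_f\models\Phi(\bar a)\}$, with $d(\Phi)=-\infty$ if no tuple of $M_f$ satisfies $\Phi$. Assume that $M_f$ is elementarily equivalent to an ultraproduct $\prod_U F_i$ of finite (nonempty) $L$-structures, where $U$ is an ultrafilter on some index set. Let $\Delta(\Phi)$ be the coarse pseudofinite dimension of $\Phi$, that is, the standard part of the nonstandard real $\prod_U\log|\Phi(F_i)|/\log|F_i|$ (equivalently, the limit of $\log|\Phi(F_i)|/\log|F_i|$ along $U$ in $[-\infty,\infty]$, with $\log 0=-\infty$). Then $$\Delta(\Phi)=d(\Phi)$$ for every $L$-formula $\Phi(\bar x)$ without parameters. -/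

import Mathlib

open FirstOrder FirstOrder.Language Filter Topology

namespace HrushovskiGeneric

noncomputable section

open scoped Classical in
/-- The predimension `δ(A) = |A| - ∑ R, |R[A]|` of a finite subset `A` of an `L`-structure. Here `L`
has finitely many relation symbols and `R[A]` is the set of tuples from `A` that satisfy `R`. -/
def predim (L : FirstOrder.Language) [Fintype (Σ n, L.Relations n)] {M : Type*} [L.Structure M]
    (A : Finset M) : ℤ :=
  (A.card : ℤ) - ∑ R : (Σ n, L.Relations n),
    (Set.ncard {x : Fin R.1 → M | Structure.RelMap R.2 x ∧ ∀ i, x i ∈ A} : ℤ)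

/-- `A ≤ B` for finite subsets of an `L`-structure: `A ⊆ B`, and `δ(A) < δ(B')` whenever
`A ⊂ B' ⊆ B`. -/
def FinSelfSufficient (L : FirstOrder.Language) [Fintype (Σ n, L.Relations n)] {M : Type*} [L.Structure M]
    (A B : Finset M) : Prop :=
  A ⊆ B ∧ ∀ B' : Finset M, A ⊂ B' → B' ⊆ B → predim L A < predim L B'

open scoped Classical in
/-- `A ≤ M` for an arbitrary subset `A` of an `L`-structure `M`: `A ∩ X ≤ X` for all finite
`X ⊆ M`. -/
def SelfSufficient (L : FirstOrder.Language) [Fintype (Σ n, L.Relations n)] {M : Type*} [L.Structure M]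
    (A : Set M) : Prop :=
  ∀ X : Finset M, FinSelfSufficient L (X.filter (· ∈ A)) X

/-- Membership of the `L`-structure `B` in the class `𝒦_f`: `B` is finite, `∅ ≤ B`, and
`δ(X) ≥ f(|X|)` for all `X ⊆ B`. -/
structure InClass (L : FirstOrder.Language) [Fintype (Σ n, L.Relations n)] (f : ℝ → ℝ)
    (B : Type*) [L.Structure B] : Prop where
  finite : Finite B
  empty_le : SelfSufficient L (∅ : Set B)
  bound : ∀ X : Finset B, f (X.card : ℝ) ≤ (predim L X : ℝ)

/-- `M` is the generic structure `M_f` of `(𝒦_f, ≤)`, by its characterising properties. -/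
structure IsGeneric.{u, v, w} (L : FirstOrder.Language.{u, v}) [Fintype (Σ n, L.Relations n)] (f : ℝ → ℝ)
    (M : Type w) [L.Structure M] : Prop where
  /-- `M` is the union of a chain of finite self-sufficient substructures, all in `𝒦_f`. -/
  chain : ∃ S : ℕ → L.Substructure M, Monotone S ∧
    (∀ k, InClass L f (S k) ∧ SelfSufficient L (S k : Set M)) ∧ ∀ x : M, ∃ k, x ∈ S k
  /-- The `≤`-extension property. The inclusion of `A` in `B` is given as an embedding `g`. -/
  extension : ∀ (A : L.Substructure M), (A : Set M).Finite → SelfSufficient L (A : Set M) →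
    ∀ (B : Type w) [L.Structure B], InClass L f B →
      ∀ g : A ↪[L] B, SelfSufficient L (Set.range g) →
        ∃ β : B ↪[L] M, SelfSufficient L (Set.range β) ∧ ∀ a : A, β (g a) = (a : M)

open scoped Classical in
/-- The dimension `d(a) = min {δ(Y) : a ⊆ Y ⊆ M, Y finite}` of a finite tuple `a` of `M`. -/
def tupleDim (L : FirstOrder.Language) [Fintype (Σ n, L.Relations n)] {M : Type*} [L.Structure M]
    {n : ℕ} (a : Fin n → M) : ℤ :=
  sInf {z : ℤ | ∃ Y : Finset M, Finset.univ.image a ⊆ Y ∧ z = predim L Y}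

/-- The dimension `d(Φ)` of a parameter-free formula, evaluated in `M`: the largest value of `d(a)`
for `a` satisfying `Φ` in `M`. It is `⊥ = -∞` if no tuple satisfies `Φ`. -/
def formulaDim {L : FirstOrder.Language} [Fintype (Σ n, L.Relations n)] (M : Type*) [L.Structure M]
    {n : ℕ} (Φ : L.Formula (Fin n)) : EReal :=
  ⨆ a : {a : Fin n → M // Φ.Realize a}, ((tupleDim L a.1 : ℝ) : EReal)

/-- The quotient `log |Φ(F)| / log |F|` for a finite structure `F`, with `log 0 = -∞`. -/
def logRatio {L : FirstOrder.Language} (F : Type*) [L.Structure F] {n : ℕ} (Φ : L.Formula (Fin n)) : EReal :=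
  ENNReal.log (Nat.card {v : Fin n → F // Φ.Realize v} : ENNReal) /
    ENNReal.log (Nat.card F : ENNReal)

/-- The coarse pseudofinite dimension `Δ(Φ)` with respect to the ultraproduct of the finite
structures `F i` along `U`: the standard part of the class of `log |Φ(F i)| / log |F i|` modulo `U`,
that is, the limit along `U` in the compact space `[-∞, ∞]`. -/
def coarseDim {L : FirstOrder.Language} {ι : Type*} (U : Ultrafilter ι) (F : ι → Type*)
    [∀ i, L.Structure (F i)] {n : ℕ} (Φ : L.Formula (Fin n)) : EReal :=
  (U.map fun i => logRatio (F i) Φ).lim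

/-- The limit in the definition of `coarseDim` always exists. -/
theorem tendsto_coarseDim {L : FirstOrder.Language} {ι : Type*} (U : Ultrafilter ι) (F : ι → Type*)
    [∀ i, L.Structure (F i)] {n : ℕ} (Φ : L.Formula (Fin n)) :
    Tendsto (fun i => logRatio (F i) Φ) U (𝓝 (coarseDim U F Φ)) :=
  Ultrafilter.le_nhds_lim (U.map fun i => logRatio (F i) Φ)

end

end HrushovskiGeneric

/-! Since `f` tends to infinity, a finite set of bounded predimension has bounded size. So every
finite set has a finite closure, of size bounded in terms of its dimension, and the condition `d ≤
r` is first-order (`Admissible.definable_setDim_le`). This makes it possible to compare the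
dimension in the generic structure with counting in the finite structures.

Upper bound. A realisation of `Φ` of dimension `k` contains a basis of `k` coordinates, and the
other coordinates lie in the closure of the basis. Hence `Φ` is covered by finitely many formulas
with uniformly bounded fibres over at most `d(Φ)` coordinates. Bounded fibres transfer, so `|Φ(F)| ≤
C |F| ^ d(Φ)` for almost all `F` (`Admissible.exists_ncard_mul_le`).

Lower bound. Let `a` realise `Φ`, with an independent subtuple of size `k = d(a)`. For every
independent family `y` of `m * k` elements there are `m` realisations of `Φ` and a single point `x`
such that `R` relates `x`, each `y (i, j)` and the `j`-th basis coordinate of the `i`-th realisation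
(`IsGeneric.exists_common_point`). The point is built in `Join`: both families being independent,
the many new relations are paid for on either side, so both sides stay self-sufficient. The growth
condition on `f` keeps the result in the class. Self-sufficient copies satisfy the same formulas
(`IsGeneric.boundedFormula_realize_iff`), so the copied tuples still realise `Φ`.

In a finite `F`, the outer coordinates of `R` determine the middle one up to `K` choices, so a fixed
`x` serves at most `(|Φ(F)| K ^ k) ^ m` families `y`. Dependent families are at most half of all,
whence `|F| ^ (m * k) ≤ 2 |F| (|Φ(F)| K ^ k) ^ m`. The factor `|F|` for the choice of `x` is paid
only once, so taking logarithms gives `Δ(Φ) ≥ k - 1 / m` for all `m ≥ 1`. -/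

namespace HrushovskiGeneric

open Structure

/-! ### Predimension: submodularity and invariance under embeddings -/

section RelSet

variable {L : FirstOrder.Language} {M : Type*} [L.Structure M]

/-- The set of all pairs of a relation symbol and a tuple from `A` that satisfies it. -/
def relSet (L : FirstOrder.Language) {M : Type*} [L.Structure M] (A : Set M) :
    Set (Σ R : (Σ n, L.Relations n), (Fin R.1 → M)) :=
  {p | RelMap p.1.2 p.2 ∧ ∀ i, p.2 i ∈ A}

theorem relSet_mono {A B : Set M} (h : A ⊆ B) : relSet L A ⊆ relSet L B :=
  fun _ hp => ⟨hp.1, fun i => h (hp.2 i)⟩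

theorem relSet_inter (A B : Set M) : relSet L (A ∩ B) = relSet L A ∩ relSet L B := by
  ext p
  simp only [relSet, Set.mem_ofPred_eq, Set.mem_inter_iff]
  exact ⟨fun h => ⟨⟨h.1, fun i => (h.2 i).1⟩, h.1, fun i => (h.2 i).2⟩,
    fun h => ⟨h.1.1, fun i => ⟨h.1.2 i, h.2.2 i⟩⟩⟩

theorem finite_tuples_in (A : Finset M) (k : ℕ) (P : (Fin k → M) → Prop) :
    {x : Fin k → M | P x ∧ ∀ i, x i ∈ A}.Finite :=
  (Set.Finite.pi' fun _ : Fin k => A.finite_toSet).subset fun _ hx => hx.2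

theorem relSet_empty [IsEmpty (L.Relations 0)] : relSet L (∅ : Set M) = ∅ := by
  ext ⟨⟨k, R⟩, x⟩
  simp only [Set.mem_empty_iff_false, iff_false]
  rintro ⟨-, h⟩
  rcases k with _ | k
  · exact isEmptyElim R
  · exact h 0

end RelSet

section Predimension

variable {L : FirstOrder.Language} [Fintype (Σ n, L.Relations n)] {M N : Type*}
  [L.Structure M] [L.Structure N]

theorem relSet_finite (A : Finset M) : (relSet L (A : Set M)).Finite := by
  have : relSet L (A : Set M) ⊆ ⋃ R : (Σ n, L.Relations n),
      (Sigma.mk R) '' {x : Fin R.1 → M | RelMap R.2 x ∧ ∀ i, x i ∈ A} := by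
    rintro ⟨R, x⟩ hx
    exact Set.mem_iUnion.2 ⟨R, x, hx, rfl⟩
  exact (Set.finite_iUnion fun R => (finite_tuples_in A _ _).image _).subset this

theorem predim_eq (A : Finset M) :
    predim L A = (A.card : ℤ) - ((relSet L (A : Set M)).ncard : ℤ) := by
  classical
  have e : (relSet L (A : Set M)) ≃
      Σ R : (Σ n, L.Relations n), {x : Fin R.1 → M // RelMap R.2 x ∧ ∀ i, x i ∈ A} :=
    { toFun := fun p => ⟨p.1.1, p.1.2, p.2⟩
      invFun := fun p => ⟨⟨p.1, p.2.1⟩, p.2.2⟩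
      left_inv := fun _ => rfl
      right_inv := fun _ => rfl }
  have : ∀ R : (Σ n, L.Relations n),
      Finite {x : Fin R.1 → M // RelMap R.2 x ∧ ∀ i, x i ∈ A} :=
    fun R => (finite_tuples_in A _ _).to_subtype
  have h : (relSet L (A : Set M)).ncard = ∑ R : (Σ n, L.Relations n),
      Set.ncard {x : Fin R.1 → M | RelMap R.2 x ∧ ∀ i, x i ∈ A} := by
    rw [← Nat.card_coe_set_eq, Nat.card_congr e, Nat.card_sigma]
    rfl
  rw [predim, h]
  push_cast
  congr

/-- Cardinality is modular, while a tuple inside `A` or inside `B` is inside the union, which may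
contain further related tuples. -/
theorem predim_union_add_inter_le [DecidableEq M] (A B : Finset M) :
    predim L (A ∪ B) + predim L (A ∩ B) ≤ predim L A + predim L B := by
  simp only [predim_eq, Finset.coe_union, Finset.coe_inter]
  have h1 := Finset.card_union_add_card_inter A B
  have h2 := Set.ncard_union_add_ncard_inter (relSet L (A : Set M)) (relSet L (B : Set M))
    (relSet_finite A) (relSet_finite B)
  have h3 : (relSet L (A : Set M) ∪ relSet L (B : Set M)).ncard ≤
      (relSet L ((A : Set M) ∪ B)).ncard := by
    refine Set.ncard_le_ncard (Set.union_subset (relSet_mono Set.subset_union_left)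
      (relSet_mono Set.subset_union_right)) ?_
    rw [← Finset.coe_union]
    exact relSet_finite _
  rw [relSet_inter]
  omega

theorem predim_map (A : Finset M) (g : M ↪[L] N) : predim L (A.map g.toEmbedding) = predim L A := by
  have hs : relSet L ((A.map g.toEmbedding : Finset N) : Set N) =
      (fun p : Σ R : (Σ n, L.Relations n), (Fin R.1 → M) =>
        (⟨p.1, g ∘ p.2⟩ : Σ R : (Σ n, L.Relations n), (Fin R.1 → N))) '' relSet L (A : Set M) := by
    ext ⟨R, x⟩
    constructor
    · rintro ⟨h1, h2⟩
      have : ∀ i, ∃ a ∈ A, g a = x i := fun i => Finset.mem_map.1 (h2 i)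
      choose y hy hyx using this
      obtain rfl : g ∘ y = x := funext hyx
      exact ⟨⟨R, y⟩, ⟨(g.map_rel R.2 y).1 h1, hy⟩, rfl⟩
    · rintro ⟨⟨R', y⟩, ⟨h1, h2⟩, h⟩
      cases h
      refine ⟨(g.map_rel R'.2 y).2 h1, fun i => ?_⟩
      exact Finset.mem_map.2 ⟨_, h2 i, rfl⟩
  rw [predim_eq, predim_eq, hs, Finset.card_map, Set.ncard_image_of_injective]
  rintro ⟨R, x⟩ ⟨R', x'⟩ h
  obtain ⟨rfl, h⟩ := Sigma.mk.inj_iff.1 h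
  obtain rfl : x = x' := g.injective.comp_left (eq_of_heq h)
  rfl

@[simp]
theorem predim_empty [IsEmpty (L.Relations 0)] : predim L (∅ : Finset M) = 0 := by
  simp [predim_eq, relSet_empty]

end Predimension

/-! ### Self-sufficient sets -/

section SelfSufficient

variable {L : FirstOrder.Language} [Fintype (Σ n, L.Relations n)] {M N : Type*}
  [L.Structure M] [L.Structure N]

open scoped Classical in
theorem selfSufficient_iff {A : Set M} : SelfSufficient L A ↔
    ∀ Z : Finset M, ¬ (Z : Set M) ⊆ A → predim L (Z.filter (· ∈ A)) < predim L Z := by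
  constructor
  · intro h Z hZ
    refine (h Z).2 Z ⟨Finset.filter_subset _ _, fun h' => hZ fun x hx => ?_⟩ subset_rfl
    exact (Finset.mem_filter.1 (h' hx)).2
  · intro h X
    refine ⟨Finset.filter_subset _ _, fun B hXB hBX => ?_⟩
    have : X.filter (· ∈ A) = B.filter (· ∈ A) := by
      ext x
      simp only [Finset.mem_filter]
      exact ⟨fun hx => ⟨hXB.1 (Finset.mem_filter.2 hx), hx.2⟩, fun hx => ⟨hBX hx.1, hx.2⟩⟩
    rw [this]
    refine h B fun hBA => hXB.2 fun x hx => Finset.mem_filter.2 ⟨hBX hx, hBA hx⟩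

open scoped Classical in
theorem SelfSufficient.filter_le {A : Set M} (h : SelfSufficient L A) (Z : Finset M) :
    predim L (Z.filter (· ∈ A)) ≤ predim L Z := by
  by_cases hZ : (Z : Set M) ⊆ A
  · rw [Finset.filter_true_of_mem fun x hx => hZ hx]
  · exact (selfSufficient_iff.1 h Z hZ).le

theorem selfSufficient_univ : SelfSufficient L (Set.univ : Set M) :=
  selfSufficient_iff.2 fun _ h => (h (Set.subset_univ _)).elim

/-- Transitivity: cut `Z` down to the range of `g`, then to the image of `A`. Neither cut raises the
predimension, and one of them lowers it. -/
theorem SelfSufficient.image {A : Set M} (hA : SelfSufficient L A) {g : M ↪[L] N}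
    (hg : SelfSufficient L (Set.range g)) : SelfSufficient L (g '' A) := by
  classical
  refine selfSufficient_iff.2 fun Z hZ => ?_
  set Y : Finset M := Z.preimage g g.injective.injOn with hY
  have h1 : Z.filter (· ∈ Set.range g) = Y.map g.toEmbedding := by
    ext x
    simp only [Finset.mem_filter, Set.mem_range, Finset.mem_map, hY, Finset.mem_preimage]
    constructor
    · rintro ⟨hx, m, rfl⟩
      exact ⟨m, hx, rfl⟩
    · rintro ⟨m, hm, rfl⟩
      exact ⟨hm, m, rfl⟩
  have h2 : Z.filter (· ∈ g '' A) = (Y.filter (· ∈ A)).map g.toEmbedding := by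
    ext x
    simp only [Finset.mem_filter, Set.mem_image, Finset.mem_map, hY, Finset.mem_preimage]
    constructor
    · rintro ⟨hx, m, hm, rfl⟩
      exact ⟨m, ⟨hx, hm⟩, rfl⟩
    · rintro ⟨m, ⟨hm, hm'⟩, rfl⟩
      exact ⟨hm, m, hm', rfl⟩
  rw [h2, predim_map]
  have h3 := hg.filter_le Z
  rw [h1, predim_map] at h3
  by_cases hZr : (Z : Set N) ⊆ Set.range g
  · refine lt_of_lt_of_le (selfSufficient_iff.1 hA Y fun hYA => hZ fun x hx => ?_) h3
    obtain ⟨m, rfl⟩ := hZr hx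
    exact ⟨m, hYA (by simpa [hY] using hx), rfl⟩
  · have h4 := selfSufficient_iff.1 hg Z hZr
    rw [h1, predim_map] at h4
    exact (hA.filter_le Y).trans_lt h4

theorem SelfSufficient.range_comp {D : Type*} [L.Structure D] {h : D ↪[L] M} {g : M ↪[L] N}
    (hh : SelfSufficient L (Set.range h)) (hg : SelfSufficient L (Set.range g)) :
    SelfSufficient L (Set.range (g.comp h)) := by
  have : Set.range (g.comp h) = g '' Set.range h := by
    rw [← Set.range_comp]; rfl
  rw [this]
  exact hh.image hg

/-- By submodularity, passing from `C ∩ Z` to `Z` gains at least as much predimension as passing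
from `C` to `C ∪ Z`. -/
theorem selfSufficient_coe_of_forall {C : Finset M}
    (h : ∀ Z : Finset M, C ⊂ Z → predim L C < predim L Z) : SelfSufficient L (C : Set M) := by
  classical
  refine selfSufficient_iff.2 fun Z hZ => ?_
  have h1 := predim_union_add_inter_le (L := L) C Z
  have h2 : predim L (Z.filter (· ∈ (C : Set M))) = predim L (C ∩ Z) := by
    congr 1; ext x; simp [and_comm]
  have h3 := h (C ∪ Z) ⟨Finset.subset_union_left, fun h' => hZ fun x hx =>
    h' (Finset.mem_union_right _ hx)⟩
  have h4 : predim L (C ∩ Z) < predim L Z := by omega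
  rw [← h2] at h4
  convert h4

theorem SelfSufficient.predim_lt {C Z : Finset M} (hC : SelfSufficient L (C : Set M))
    (h : C ⊂ Z) : predim L C < predim L Z := by
  classical
  have := selfSufficient_iff.1 hC Z (by simpa using h.2)
  convert this using 2
  ext x
  simp only [Finset.mem_filter, Finset.mem_coe]
  exact ⟨fun hx => ⟨h.1 hx, hx⟩, fun h => h.2⟩

theorem SelfSufficient.preimage {A : Set N} {g : M ↪[L] N} (h : SelfSufficient L A) :
    SelfSufficient L (g ⁻¹' A) := by
  classical
  refine selfSufficient_iff.2 fun Z hZ => ?_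
  have h1 := selfSufficient_iff.1 h (Z.map g.toEmbedding) (by
    rw [Finset.coe_map]
    exact fun h' => hZ fun x hx => h' ⟨x, hx, rfl⟩)
  rw [predim_map, Finset.filter_map, predim_map] at h1
  exact h1

end SelfSufficient

/-! ### Dimension, closure, bases and independence -/

section Dimension

variable {L : FirstOrder.Language} [Fintype (Σ n, L.Relations n)] {M N : Type*}
  [L.Structure M] [L.Structure N]

/-- The two conditions on the finite subsets of a structure in `𝒦_f`. -/
def Admissible (L : FirstOrder.Language) [Fintype (Σ n, L.Relations n)] (f : ℝ → ℝ)
    (M : Type*) [L.Structure M] : Prop :=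
  (∀ X : Finset M, X.Nonempty → 0 < predim L X) ∧ ∀ X : Finset M, f X.card ≤ predim L X

theorem Admissible.of_embedding {f : ℝ → ℝ} (h : Admissible L f N) (g : M ↪[L] N) :
    Admissible L f M := by
  refine ⟨fun X hX => ?_, fun X => ?_⟩
  · rw [← predim_map X g]
    exact h.1 _ (by simpa using hX)
  · rw [← predim_map X g]
    simpa using h.2 (X.map g.toEmbedding)

theorem inClass_iff [IsEmpty (L.Relations 0)] {f : ℝ → ℝ} :
    InClass L f M ↔ Finite M ∧ Admissible L f M := by
  classical
  have key : SelfSufficient L (∅ : Set M) ↔ ∀ X : Finset M, X.Nonempty → 0 < predim L X := by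
    rw [selfSufficient_iff]
    refine forall_congr' fun X => ?_
    simp [Finset.nonempty_iff_ne_empty]
  exact ⟨fun h => ⟨h.1, key.1 h.2, h.3⟩, fun h => ⟨h.1, key.2 h.2.1, h.2.2⟩⟩

theorem Admissible.predim_nonneg [IsEmpty (L.Relations 0)] {f : ℝ → ℝ} (h : Admissible L f M)
    (X : Finset M) : 0 ≤ predim L X := by
  rcases X.eq_empty_or_nonempty with rfl | hX
  · simp
  · exact (h.1 X hX).le

/-- The source of every uniform bound below: sizes of closures, definability of dimension, sizes of
fibres. -/
theorem Admissible.exists_card_le {f : ℝ → ℝ} (hf : Tendsto f atTop atTop) (h : Admissible L f M)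
    (r : ℤ) : ∃ K : ℕ, ∀ X : Finset M, predim L X ≤ r → X.card ≤ K := by
  obtain ⟨K, hK⟩ := ((hf.comp tendsto_natCast_atTop_atTop).eventually_gt_atTop (r : ℝ)).exists_forall_of_atTop
  refine ⟨K, fun X hX => ?_⟩
  by_contra! hlt
  have h1 := hK X.card hlt.le
  have h2 := h.2 X
  have h3 : (predim L X : ℝ) ≤ r := by exact_mod_cast hX
  simp only [Function.comp] at h1
  linarith

/-- The dimension `d(X) = min {δ(Y) : X ⊆ Y}` of a finite set. -/
noncomputable def setDim (L : FirstOrder.Language) [Fintype (Σ n, L.Relations n)] {M : Type*}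
    [L.Structure M] (X : Finset M) : ℤ :=
  sInf {z : ℤ | ∃ Y : Finset M, X ⊆ Y ∧ z = predim L Y}

open scoped Classical in
theorem tupleDim_eq {n : ℕ} (a : Fin n → M) :
    tupleDim L a = setDim L (Finset.univ.image a) := rfl

section

variable [IsEmpty (L.Relations 0)] {f : ℝ → ℝ} (hM : Admissible L f M)

include hM

theorem Admissible.setDim_le {X Y : Finset M} (h : X ⊆ Y) : setDim L X ≤ predim L Y :=
  csInf_le ⟨0, by rintro _ ⟨Z, -, rfl⟩; exact hM.predim_nonneg Z⟩ ⟨Y, h, rfl⟩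

theorem Admissible.exists_setDim_eq (X : Finset M) :
    ∃ Y : Finset M, X ⊆ Y ∧ setDim L X = predim L Y :=
  Int.csInf_mem (s := {z : ℤ | ∃ Y : Finset M, X ⊆ Y ∧ z = predim L Y})
    ⟨_, X, subset_rfl, rfl⟩ ⟨0, by rintro _ ⟨Z, -, rfl⟩; exact hM.predim_nonneg Z⟩

theorem Admissible.setDim_le_iff {X : Finset M} {r : ℤ} :
    setDim L X ≤ r ↔ ∃ Y : Finset M, X ⊆ Y ∧ predim L Y ≤ r := by
  constructor
  · intro h
    obtain ⟨Y, hY, e⟩ := hM.exists_setDim_eq X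
    exact ⟨Y, hY, e ▸ h⟩
  · rintro ⟨Y, hY, h⟩
    exact (hM.setDim_le hY).trans h

theorem Admissible.le_setDim_iff {X : Finset M} {r : ℤ} :
    r ≤ setDim L X ↔ ∀ Y : Finset M, X ⊆ Y → r ≤ predim L Y := by
  constructor
  · exact fun h Y hY => h.trans (hM.setDim_le hY)
  · intro h
    obtain ⟨Y, hY, e⟩ := hM.exists_setDim_eq X
    exact e ▸ h Y hY

theorem Admissible.setDim_nonneg (X : Finset M) : 0 ≤ setDim L X :=
  hM.le_setDim_iff.2 fun Y _ => hM.predim_nonneg Y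

theorem Admissible.setDim_mono {X Y : Finset M} (h : X ⊆ Y) : setDim L X ≤ setDim L Y :=
  hM.le_setDim_iff.2 fun _ hZ => hM.setDim_le (h.trans hZ)

theorem Admissible.setDim_insert_le [DecidableEq M] (X : Finset M) (a : M) :
    setDim L (insert a X) ≤ setDim L X + 1 := by
  obtain ⟨Y, hY, e⟩ := hM.exists_setDim_eq X
  refine (hM.setDim_le (Finset.insert_subset_insert a hY)).trans ?_
  have h1 := predim_union_add_inter_le (L := L) {a} Y
  rw [← Finset.insert_eq] at h1
  have h2 := hM.predim_nonneg ({a} ∩ Y)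
  have h3 : predim L ({a} : Finset M) ≤ 1 := by
    rw [predim_eq]; simp
  omega

/-- Every finite set has a closure. -/
theorem Admissible.exists_closure (hf : Tendsto f atTop atTop) (X : Finset M) :
    ∃ C : Finset M, X ⊆ C ∧ predim L C = setDim L X ∧ SelfSufficient L (C : Set M) ∧
      ∀ Y, X ⊆ Y → predim L Y ≤ setDim L X → Y ⊆ C := by
  classical
  obtain ⟨K, hK⟩ := hM.exists_card_le hf (setDim L X)
  obtain ⟨Y₀, hY₀, e₀⟩ := hM.exists_setDim_eq X
  -- The closure is a minimiser of largest size. By submodularity its union with another minimiser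
  -- is again one, hence no larger.
  let P : ℕ → Prop := fun k => ∃ Y : Finset M, X ⊆ Y ∧ predim L Y ≤ setDim L X ∧ Y.card = k
  have hP : P (Nat.findGreatest P K) :=
    Nat.findGreatest_spec (hK Y₀ e₀.ge) ⟨Y₀, hY₀, e₀.ge, rfl⟩
  obtain ⟨C, hXC, hC, hcard⟩ := hP
  have hCe : predim L C = setDim L X := le_antisymm hC (hM.setDim_le hXC)
  have hmax : ∀ Y, C ⊆ Y → predim L Y ≤ setDim L X → Y = C := by
    intro Y hCY hY
    refine (Finset.eq_of_subset_of_card_le hCY ?_).symm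
    rw [hcard]
    exact Nat.le_findGreatest (hK Y hY) ⟨Y, hXC.trans hCY, hY, rfl⟩
  refine ⟨C, hXC, hCe, selfSufficient_coe_of_forall fun Z hZ => ?_, fun Y hXY hY => ?_⟩
  · by_contra! hle
    exact hZ.2 (hmax Z hZ.1 (hle.trans hC)).le
  · have h1 := predim_union_add_inter_le (L := L) C Y
    have h2 := hM.setDim_le (Finset.subset_inter hXC hXY)
    exact Finset.union_eq_left.1 (hmax (C ∪ Y) Finset.subset_union_left (by omega))

/-- Every family contains a basis, whose size is the dimension. -/
theorem Admissible.exists_basis [DecidableEq M] {ι : Type*} [DecidableEq ι] (a : ι → M)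
    (hf : Tendsto f atTop atTop) (T : Finset ι) : ∃ S ⊆ T,
      (S.card : ℤ) = setDim L (S.image a) ∧ setDim L (S.image a) = setDim L (T.image a) := by
  induction T using Finset.induction_on with
  | empty =>
    refine ⟨∅, subset_rfl, ?_, rfl⟩
    have h1 := hM.setDim_le (subset_refl (∅ : Finset M))
    have h2 := hM.setDim_nonneg (∅ : Finset M)
    simp only [predim_empty] at h1
    simp
    omega
  | insert j T hj ih =>
    obtain ⟨S, hST, hS, hSe⟩ := ih
    by_cases hd : setDim L ((insert j T).image a) ≤ setDim L (T.image a)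
    · refine ⟨S, hST.trans (Finset.subset_insert _ _), hS, ?_⟩
      have := hM.setDim_mono (Finset.image_subset_image (f := a) (Finset.subset_insert j T))
      omega
    -- Exchange: the closure `C` of the image of `S` contains that of `T`. For `Y` containing the
    -- image of `insert j S`, replacing `Y` by `Y ∪ C` does not raise the predimension, since `Y ∩
    -- C` still contains the image of `S`.
    · have h1 : setDim L ((insert j T).image a) ≤ setDim L ((insert j S).image a) := by
        rw [Finset.image_insert, Finset.image_insert, hM.le_setDim_iff]
        intro Y hY
        obtain ⟨C, hC, hCe, -, hCmax⟩ := hM.exists_closure hf (S.image a)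
        obtain ⟨D, hD, hDe⟩ := hM.exists_setDim_eq (T.image a)
        have hTC : T.image a ⊆ C :=
          hD.trans (hCmax D ((Finset.image_subset_image hST).trans hD) (by omega))
        have h2 := predim_union_add_inter_le (L := L) Y C
        have h3 := hM.setDim_le (Finset.subset_inter
          ((Finset.subset_insert _ _).trans hY) hC)
        refine (hM.setDim_le (Y := Y ∪ C) ?_).trans (by omega)
        refine Finset.insert_subset (Finset.mem_union_left _ (hY (Finset.mem_insert_self _ _)))
          (hTC.trans Finset.subset_union_right)
      have h2 := hM.setDim_mono (Finset.image_subset_image (f := a) (Finset.insert_subset_insert j hST))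
      have h3 : setDim L ((insert j S).image a) ≤ setDim L (S.image a) + 1 := by
        rw [Finset.image_insert]
        exact hM.setDim_insert_le _ _
      refine ⟨insert j S, Finset.insert_subset_insert j hST, ?_, le_antisymm h2 h1⟩
      rw [Finset.card_insert_of_notMem fun h => hj (hST h)]
      push_cast
      omega

end

/-- A family is independent if every finite set has at least the predimension of the number of
its members that it contains. -/
def Indep (L : FirstOrder.Language) [Fintype (Σ n, L.Relations n)] {M : Type*} [L.Structure M]
    {I : Type*} (y : I → M) : Prop :=
  ∀ X : Finset M, ({i | y i ∈ X}.ncard : ℤ) ≤ predim L X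

open scoped Classical in
-- Adjoining to `X` the members of the family outside it costs at most one dimension each, and must
-- reach dimension at least `Fintype.card I`.
theorem Admissible.indep_of_card_le_setDim [IsEmpty (L.Relations 0)] {f : ℝ → ℝ}
    (hM : Admissible L f M) {I : Type*} [Fintype I] {y : I → M}
    (h : (Fintype.card I : ℤ) ≤ setDim L (Finset.univ.image y)) : Indep L y := by
  intro X
  have key : ∀ T : Finset I, setDim L (X ∪ T.image y) ≤ predim L X + T.card := by
    intro T
    induction T using Finset.induction_on with
    | empty => simpa using hM.setDim_le subset_rfl
    | insert j T hj ih =>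
      rw [Finset.image_insert, Finset.union_insert, Finset.card_insert_of_notMem hj]
      have := hM.setDim_insert_le (X ∪ T.image y) (y j)
      push_cast
      omega
  have h1 := key {i | y i ∉ X}
  have h2 : Finset.univ.image y ⊆ X ∪ ({i | y i ∉ X} : Finset I).image y := by
    intro m hm
    obtain ⟨i, -, rfl⟩ := Finset.mem_image.1 hm
    by_cases hi : y i ∈ X
    · exact Finset.mem_union_left _ hi
    · exact Finset.mem_union_right _ (Finset.mem_image_of_mem _ (by simpa using hi))
  have h3 := hM.setDim_mono h2
  have h4 : {i | y i ∈ X}.ncard = ({i | y i ∈ X} : Finset I).card := by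
    rw [← Set.ncard_coe_finset]; congr 1; ext; simp
  have h5 := Finset.card_filter_add_card_filter_not (s := (Finset.univ : Finset I)) (fun i => y i ∈ X)
  rw [Finset.card_univ] at h5
  rw [h4]
  omega

end Dimension

/-- On an interval of length `a + 1` with slope at most `1 / (2 * (a + 1))`, the growth is at most
`1 / 2`. Only the bound `1` is needed: the least gain in an integer predimension. -/
theorem apply_two_mul_add_one_le {f f' : ℝ → ℝ} (hf_cont : ContinuousOn f (Set.Ici 0))
    (hf_deriv : ∀ x, 0 ≤ x → HasDerivWithinAt f (f' x) (Set.Ici x) x)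
    (hf_bound : ∀ x, 0 ≤ x → f' x ≤ 1 / (2 * (x + 1))) {a : ℝ} (ha : 0 ≤ a) :
    f (2 * a + 1) ≤ f a + 1 := by
  have h := image_le_of_deriv_right_le_deriv_boundary (f := f) (f' := f') (a := a)
    (b := 2 * a + 1) (hf_cont.mono fun x hx => ha.trans hx.1)
    (fun x hx => hf_deriv x (ha.trans hx.1))
    (B := fun x => f a + (x - a) * (1 / (2 * (a + 1)))) (B' := fun _ => 1 / (2 * (a + 1)))
    (by simp) (by fun_prop)
    (fun x _ => by
      simpa using ((((hasDerivAt_id x).sub_const a).mul_const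
        (1 / (2 * (a + 1)))).const_add (f a)).hasDerivWithinAt)
    (fun x hx => (hf_bound x (ha.trans hx.1)).trans (by
      have := hx.1
      gcongr))
    (x := 2 * a + 1) ⟨by linarith, le_rfl⟩
  have h1 : (2 * a + 1 - a) * (1 / (2 * (a + 1))) = 1 / 2 := by
    field_simp; ring
  simp only [h1] at h
  linarith

/-! ### Joining two structures by a single new point -/

section Join

variable {L : FirstOrder.Language} {C W I : Type*}

/-- The disjoint union of `C` and `W` with one further point. -/
@[nolint unusedArguments]
def Join (_R : L.Relations 3) (_y : I → C) (_z : I → W) : Type _ := Option (C ⊕ W)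

variable (R : L.Relations 3) (y : I → C) (z : I → W)

/-- The new point of `Join R y z`. -/
def Join.pt : Join R y z := (none : Option (C ⊕ W))

/-- The inclusion of the first summand. -/
def Join.inl (c : C) : Join R y z := some (Sum.inl c)

/-- The inclusion of the second summand. -/
def Join.inr (w : W) : Join R y z := some (Sum.inr w)

instance [Finite C] [Finite W] : Finite (Join R y z) :=
  inferInstanceAs (Finite (Option (C ⊕ W)))

theorem Join.inl_injective : Function.Injective (Join.inl R y z) := fun _ _ h =>
  Sum.inl_injective (Option.some_injective _ h)

theorem Join.inr_injective : Function.Injective (Join.inr R y z) := fun _ _ h =>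
  Sum.inr_injective (Option.some_injective _ h)

theorem Join.inl_ne_inr (c : C) (w : W) : Join.inl R y z c ≠ Join.inr R y z w := fun h => by
  cases h

theorem Join.inl_ne_pt (c : C) : Join.inl R y z c ≠ Join.pt R y z := fun h => by cases h

theorem Join.inr_ne_pt (w : W) : Join.inr R y z w ≠ Join.pt R y z := fun h => by cases h

theorem Join.cases_of (x : Join R y z) : (∃ c, x = Join.inl R y z c) ∨
    (∃ w, x = Join.inr R y z w) ∨ x = Join.pt R y z := by
  rcases x with _ | c | w
  · exact Or.inr (Or.inr rfl)
  · exact Or.inl ⟨c, rfl⟩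
  · exact Or.inr (Or.inl ⟨w, rfl⟩)

/-- The trace of a set on the first summand. -/
noncomputable def Join.left (X : Finset (Join R y z)) : Finset C :=
  X.preimage (Join.inl R y z) (Join.inl_injective R y z).injOn

/-- The trace of a set on the second summand. -/
noncomputable def Join.right (X : Finset (Join R y z)) : Finset W :=
  X.preimage (Join.inr R y z) (Join.inr_injective R y z).injOn

open scoped Classical in
theorem Join.card_eq (X : Finset (Join R y z)) : X.card =
    (Join.left R y z X).card + (Join.right R y z X).card + if Join.pt R y z ∈ X then 1 else 0 := by
  have h : X = ((Join.left R y z X).map ⟨_, Join.inl_injective R y z⟩ ∪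
      (Join.right R y z X).map ⟨_, Join.inr_injective R y z⟩) ∪
      X.filter (· = Join.pt R y z) := by
    ext x
    simp only [Finset.mem_union, Finset.mem_map, Finset.mem_filter, Join.left, Join.right,
      Finset.mem_preimage]
    constructor
    · intro hx
      rcases Join.cases_of R y z x with ⟨c, rfl⟩ | ⟨w, rfl⟩ | rfl
      · exact Or.inl (Or.inl ⟨c, hx, rfl⟩)
      · exact Or.inl (Or.inr ⟨w, hx, rfl⟩)
      · exact Or.inr ⟨hx, rfl⟩
    · rintro ((⟨c, hx, rfl⟩ | ⟨w, hx, rfl⟩) | ⟨hx, -⟩) <;> exact hx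
  conv_lhs => rw [h]
  rw [Finset.card_union_of_disjoint, Finset.card_union_of_disjoint, Finset.card_map,
    Finset.card_map]
  · congr 1
    split_ifs with hp
    · rw [Finset.card_eq_one]
      refine ⟨Join.pt R y z, ?_⟩
      ext x
      simp only [Finset.mem_filter, Finset.mem_singleton]
      exact ⟨fun h => h.2, fun h => ⟨h ▸ hp, h⟩⟩
    · rw [Finset.card_eq_zero]
      ext x
      simp only [Finset.mem_filter, Finset.notMem_empty, iff_false]
      rintro ⟨h, rfl⟩
      exact hp h
  · rw [Finset.disjoint_left]
    intro x hx hx'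
    obtain ⟨c, -, rfl⟩ := Finset.mem_map.1 hx
    obtain ⟨w, -, h⟩ := Finset.mem_map.1 hx'
    exact Join.inl_ne_inr R y z _ _ h.symm
  · rw [Finset.disjoint_left]
    intro x hx hx'
    obtain ⟨-, rfl⟩ := Finset.mem_filter.1 hx'
    rcases Finset.mem_union.1 hx with hx | hx
    · obtain ⟨c, -, h⟩ := Finset.mem_map.1 hx
      exact Join.inl_ne_pt R y z _ h
    · obtain ⟨c, -, h⟩ := Finset.mem_map.1 hx
      exact Join.inr_ne_pt R y z _ h

theorem Join.pt_mem_of_eq {k : ℕ} {r : L.Relations k} {v : Fin k → Join R y z} {i : I}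
    (h : (⟨⟨k, r⟩, v⟩ : Σ Q : (Σ n, L.Relations n), (Fin Q.1 → Join R y z)) =
      ⟨⟨3, R⟩, ![Join.pt R y z, Join.inl R y z (y i), Join.inr R y z (z i)]⟩) :
    ∃ j, v j = Join.pt R y z := by
  cases h
  exact ⟨0, rfl⟩

variable [L.IsRelational] [L.Structure C] [L.Structure W]

/-- The structure on the disjoint union of `C`, `W` and a point `x` in which the only relations
besides those of `C` and `W` are `R (x, y i, z i)`. -/
instance : L.Structure (Join R y z) where
  funMap := fun f _ => isEmptyElim f
  RelMap := fun {k} r v =>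
    (∃ c : Fin k → C, v = Join.inl R y z ∘ c ∧ RelMap r c) ∨
    (∃ w : Fin k → W, v = Join.inr R y z ∘ w ∧ RelMap r w) ∨
    ∃ i, (⟨⟨k, r⟩, v⟩ : Σ Q : (Σ n, L.Relations n), (Fin Q.1 → Join R y z)) =
      ⟨⟨3, R⟩, ![Join.pt R y z, Join.inl R y z (y i), Join.inr R y z (z i)]⟩

theorem Join.relMap_iff {k : ℕ} (r : L.Relations k) (v : Fin k → Join R y z) :
    RelMap r v ↔ (∃ c : Fin k → C, v = Join.inl R y z ∘ c ∧ RelMap r c) ∨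
    (∃ w : Fin k → W, v = Join.inr R y z ∘ w ∧ RelMap r w) ∨
    ∃ i, (⟨⟨k, r⟩, v⟩ : Σ Q : (Σ n, L.Relations n), (Fin Q.1 → Join R y z)) =
      ⟨⟨3, R⟩, ![Join.pt R y z, Join.inl R y z (y i), Join.inr R y z (z i)]⟩ :=
  Iff.rfl

theorem Join.relMap_new (i : I) :
    RelMap R ![Join.pt R y z, Join.inl R y z (y i), Join.inr R y z (z i)] :=
  (Join.relMap_iff R y z _ _).2 (Or.inr (Or.inr ⟨i, rfl⟩))

variable [IsEmpty (L.Relations 0)]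

/-- The embedding of the first summand. -/
def Join.inlEmb : C ↪[L] Join R y z where
  toFun := Join.inl R y z
  inj' := Join.inl_injective R y z
  map_fun' := fun f _ => isEmptyElim f
  map_rel' := fun {k} r x => by
    rw [Join.relMap_iff]
    refine ⟨?_, fun h => Or.inl ⟨x, rfl, h⟩⟩
    rintro (⟨c, hc, h⟩ | ⟨w, hw, h⟩ | ⟨i, hi⟩)
    · rwa [(Join.inl_injective R y z).comp_left hc]
    · rcases k with _ | k
      · exact isEmptyElim r
      · exact (Join.inl_ne_inr R y z _ _ (congrFun hw 0)).elim
    · obtain ⟨j, hj⟩ := Join.pt_mem_of_eq R y z hi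
      exact (Join.inl_ne_pt R y z _ hj).elim

/-- The embedding of the second summand. -/
def Join.inrEmb : W ↪[L] Join R y z where
  toFun := Join.inr R y z
  inj' := Join.inr_injective R y z
  map_fun' := fun f _ => isEmptyElim f
  map_rel' := fun {k} r x => by
    rw [Join.relMap_iff]
    refine ⟨?_, fun h => Or.inr (Or.inl ⟨x, rfl, h⟩)⟩
    rintro (⟨c, hc, h⟩ | ⟨w, hw, h⟩ | ⟨i, hi⟩)
    · rcases k with _ | k
      · exact isEmptyElim r
      · exact (Join.inl_ne_inr R y z _ _ (congrFun hc 0).symm).elim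
    · rwa [(Join.inr_injective R y z).comp_left hw]
    · obtain ⟨j, hj⟩ := Join.pt_mem_of_eq R y z hi
      exact (Join.inr_ne_pt R y z _ hj).elim

variable [Fintype (Σ n, L.Relations n)] [Finite I]

open scoped Classical in
-- A relation inside `X` comes from one of the two traces or is one of the new triples. Distinct
-- indices may give the same triple, hence only an inequality.
theorem Join.le_predim (X : Finset (Join R y z)) :
    predim L (Join.left R y z X) + predim L (Join.right R y z X) +
      (if Join.pt R y z ∈ X then
        1 - ({i | y i ∈ Join.left R y z X ∧ z i ∈ Join.right R y z X}.ncard : ℤ) else 0) ≤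
      predim L X := by
  set A := (Join.left R y z X).map (Join.inlEmb R y z).toEmbedding with hA
  set B := (Join.right R y z X).map (Join.inrEmb R y z).toEmbedding with hB
  set J : Set I := {i | Join.pt R y z ∈ X ∧ y i ∈ Join.left R y z X ∧
    z i ∈ Join.right R y z X} with hJ
  let g : I → Σ Q : (Σ n, L.Relations n), (Fin Q.1 → Join R y z) := fun i =>
    ⟨⟨3, R⟩, ![Join.pt R y z, Join.inl R y z (y i), Join.inr R y z (z i)]⟩
  have hsub : relSet L (X : Set (Join R y z)) ⊆
      (relSet L (A : Set (Join R y z)) ∪ relSet L (B : Set (Join R y z))) ∪ g '' J := by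
    rintro ⟨⟨k, r⟩, v⟩ ⟨hr, hv⟩
    rcases (Join.relMap_iff R y z r v).1 hr with ⟨c, rfl, h⟩ | ⟨w, rfl, h⟩ | ⟨i, hi⟩
    · refine Or.inl (Or.inl ⟨hr, fun i => Finset.mem_map.2 ⟨c i, ?_, rfl⟩⟩)
      exact Finset.mem_preimage.2 (hv i)
    · refine Or.inl (Or.inr ⟨hr, fun i => Finset.mem_map.2 ⟨w i, ?_, rfl⟩⟩)
      exact Finset.mem_preimage.2 (hv i)
    · cases hi
      exact Or.inr ⟨i, ⟨hv 0, Finset.mem_preimage.2 (hv 1), Finset.mem_preimage.2 (hv 2)⟩, rfl⟩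
  have h1 := Set.ncard_le_ncard hsub
    (((relSet_finite A).union (relSet_finite B)).union (J.toFinite.image g))
  have h2 := Set.ncard_union_le (relSet L (A : Set (Join R y z)) ∪ relSet L (B : Set _)) (g '' J)
  have h3 := Set.ncard_union_le (relSet L (A : Set (Join R y z))) (relSet L (B : Set _))
  have h4 := Set.ncard_image_le (f := g) J.toFinite
  have h5 := Join.card_eq R y z X
  have h6 : predim L (Join.left R y z X) =
      (Join.left R y z X).card - (relSet L (A : Set (Join R y z))).ncard := by
    rw [← predim_map _ (Join.inlEmb R y z), predim_eq, Finset.card_map]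
  have h7 : predim L (Join.right R y z X) =
      (Join.right R y z X).card - (relSet L (B : Set (Join R y z))).ncard := by
    rw [← predim_map _ (Join.inrEmb R y z), predim_eq, Finset.card_map]
  rw [predim_eq X]
  split_ifs with hp
  · rw [if_pos hp] at h5
    have : J = {i | y i ∈ Join.left R y z X ∧ z i ∈ Join.right R y z X} := by
      rw [hJ]; simp [hp]
    rw [← this]
    omega
  · rw [if_neg hp] at h5
    have : J.ncard = 0 := by
      rw [hJ]; simp [hp]
    omega

variable {R y z}

section

open scoped Classical in
-- Independence of `z` bounds the number of new relations by the predimension of the right trace, so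
-- the right side pays for them all and the new point contributes its full `1`.
theorem Join.le_predim_left (hz : Indep L z) (X : Finset (Join R y z)) :
    predim L (Join.left R y z X) + (if Join.pt R y z ∈ X then 1 else 0) ≤ predim L X := by
  have h := Join.le_predim R y z X
  have h1 := hz (Join.right R y z X)
  have h2 : {i | y i ∈ Join.left R y z X ∧ z i ∈ Join.right R y z X}.ncard ≤
    {i | z i ∈ Join.right R y z X}.ncard := Set.ncard_le_ncard fun _ h => h.2
  split_ifs at h ⊢ <;> omega

open scoped Classical in
theorem Join.le_predim_right (hy : Indep L y) (X : Finset (Join R y z)) :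
    predim L (Join.right R y z X) + (if Join.pt R y z ∈ X then 1 else 0) ≤ predim L X := by
  have h := Join.le_predim R y z X
  have h1 := hy (Join.left R y z X)
  have h2 : {i | y i ∈ Join.left R y z X ∧ z i ∈ Join.right R y z X}.ncard ≤
    {i | y i ∈ Join.left R y z X}.ncard := Set.ncard_le_ncard fun _ h => h.1
  split_ifs at h ⊢ <;> omega

theorem Join.le_predim_of_notMem {X : Finset (Join R y z)} (hX : Join.pt R y z ∉ X) :
    predim L (Join.left R y z X) + predim L (Join.right R y z X) ≤ predim L X := by
  classical
  simpa [hX] using Join.le_predim R y z X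

end

/-- A set `X` has at most twice the size of its larger trace, plus one, so `hf_double` asks for one
more unit of predimension than that trace has. The new point supplies it or, without the point, the
nonempty smaller trace does. If the point is absent and one trace is empty, nothing extra is needed.
-/
theorem Join.admissible {f : ℝ → ℝ} (hf_mono : MonotoneOn f (Set.Ici 0))
    (hf_double : ∀ a : ℝ, 0 ≤ a → f (2 * a + 1) ≤ f a + 1)
    (hC : Admissible L f C) (hW : Admissible L f W) (hy : Indep L y) (hz : Indep L z) :
    Admissible L f (Join R y z) := by
  classical
  have hm : ∀ a b : ℕ, a ≤ 2 * b + 1 → f a ≤ f b + 1 := fun a b hab =>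
    (hf_mono (Set.mem_Ici.2 (by positivity)) (Set.mem_Ici.2 (by positivity))
      (by exact_mod_cast hab)).trans (hf_double b (by positivity))
  have hC1 := fun X : Finset C => hC.predim_nonneg X
  have hW1 := fun X : Finset W => hW.predim_nonneg X
  have hcase : ∀ X : Finset (Join R y z), Join.pt R y z ∉ X →
      (Join.left R y z X).card + (Join.right R y z X).card = X.card := fun X hp => by
    simpa [hp] using (Join.card_eq R y z X).symm
  refine ⟨fun X hX => ?_, fun X => ?_⟩
  · by_cases hp : Join.pt R y z ∈ X
    · have := Join.le_predim_left hz X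
      have := hC1 (Join.left R y z X)
      rw [if_pos hp] at *
      omega
    · have h1 := Join.le_predim_of_notMem hp
      have h2 := hcase X hp
      have h3 := hX.card_pos
      have h4 := hC1 (Join.left R y z X)
      have h5 := hW1 (Join.right R y z X)
      rcases (Join.left R y z X).eq_empty_or_nonempty with he | hne
      · have := hW.1 (Join.right R y z X) (by
          rw [← Finset.card_pos]; rw [he, Finset.card_empty] at h2; omega)
        omega
      · have := hC.1 _ hne
        omega
  · by_cases hp : Join.pt R y z ∈ X
    · have h1 := Join.le_predim_left hz X
      have h2 := Join.le_predim_right hy X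
      have h3 := Join.card_eq R y z X
      rw [if_pos hp] at h1 h2 h3
      rcases le_total (Join.left R y z X).card (Join.right R y z X).card with hle | hle
      · have h4 := hm X.card (Join.right R y z X).card (by omega)
        have h5 := hW.2 (Join.right R y z X)
        have h6 : ((predim L (Join.right R y z X) : ℤ) : ℝ) + 1 ≤ predim L X := by exact_mod_cast h2
        linarith
      · have h4 := hm X.card (Join.left R y z X).card (by omega)
        have h5 := hC.2 (Join.left R y z X)
        have h6 : ((predim L (Join.left R y z X) : ℤ) : ℝ) + 1 ≤ predim L X := by exact_mod_cast h1
        linarith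
    · have h1 := Join.le_predim_of_notMem hp
      have h2 := hcase X hp
      have h4 := hC1 (Join.left R y z X)
      have h5 := hW1 (Join.right R y z X)
      rcases (Join.left R y z X).eq_empty_or_nonempty with he | hne
      · rw [he, Finset.card_empty, zero_add] at h2
        rw [← h2]
        refine (hW.2 _).trans ?_
        exact_mod_cast (by omega)
      rcases (Join.right R y z X).eq_empty_or_nonempty with he' | hne'
      · rw [he', Finset.card_empty, add_zero] at h2
        rw [← h2]
        refine (hC.2 _).trans ?_
        exact_mod_cast (by omega)
      have h6 := hC.1 _ hne
      have h7 := hW.1 _ hne'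
      rcases le_total (Join.left R y z X).card (Join.right R y z X).card with hle | hle
      · have h8 := hm X.card (Join.right R y z X).card (by omega)
        have h9 := hW.2 (Join.right R y z X)
        have h10 : ((predim L (Join.right R y z X) : ℤ) : ℝ) + 1 ≤ predim L X := by
          exact_mod_cast (by omega)
        linarith
      · have h8 := hm X.card (Join.left R y z X).card (by omega)
        have h9 := hC.2 (Join.left R y z X)
        have h10 : ((predim L (Join.left R y z X) : ℤ) : ℝ) + 1 ≤ predim L X := by
          exact_mod_cast (by omega)
        linarith

theorem Join.selfSufficient_inl {f : ℝ → ℝ} (hW : Admissible L f W) (hz : Indep L z) :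
    SelfSufficient L (Set.range (Join.inlEmb R y z)) := by
  classical
  refine selfSufficient_iff.2 fun X hX => ?_
  have e : X.filter (· ∈ Set.range (Join.inlEmb R y z)) =
      (Join.left R y z X).map (Join.inlEmb R y z).toEmbedding := by
    ext x
    simp only [Finset.mem_filter, Set.mem_range, Finset.mem_map, Join.left, Finset.mem_preimage]
    constructor
    · rintro ⟨hx, c, rfl⟩
      exact ⟨c, hx, rfl⟩
    · rintro ⟨c, hx, rfl⟩
      exact ⟨hx, c, rfl⟩
  rw [e, predim_map]
  by_cases hp : Join.pt R y z ∈ X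
  · have := Join.le_predim_left hz X
    rw [if_pos hp] at this
    omega
  · have h1 := Join.le_predim_of_notMem hp
    obtain ⟨x, hx, hx'⟩ := Set.not_subset.1 hX
    have h2 := hW.1 (Join.right R y z X) (by
      rcases Join.cases_of R y z x with ⟨c, rfl⟩ | ⟨w, rfl⟩ | rfl
      · exact (hx' ⟨c, rfl⟩).elim
      · exact ⟨w, Finset.mem_preimage.2 hx⟩
      · exact (hp hx).elim)
    omega

theorem Join.selfSufficient_inr {f : ℝ → ℝ} (hC : Admissible L f C) (hy : Indep L y) :
    SelfSufficient L (Set.range (Join.inrEmb R y z)) := by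
  classical
  refine selfSufficient_iff.2 fun X hX => ?_
  have e : X.filter (· ∈ Set.range (Join.inrEmb R y z)) =
      (Join.right R y z X).map (Join.inrEmb R y z).toEmbedding := by
    ext x
    simp only [Finset.mem_filter, Set.mem_range, Finset.mem_map, Join.right, Finset.mem_preimage]
    constructor
    · rintro ⟨hx, c, rfl⟩
      exact ⟨c, hx, rfl⟩
    · rintro ⟨c, hx, rfl⟩
      exact ⟨hx, c, rfl⟩
  rw [e, predim_map]
  by_cases hp : Join.pt R y z ∈ X
  · have := Join.le_predim_right hy X
    rw [if_pos hp] at this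
    omega
  · have h1 := Join.le_predim_of_notMem hp
    obtain ⟨x, hx, hx'⟩ := Set.not_subset.1 hX
    have h2 := hC.1 (Join.left R y z X) (by
      rcases Join.cases_of R y z x with ⟨c, rfl⟩ | ⟨w, rfl⟩ | rfl
      · exact ⟨c, Finset.mem_preimage.2 hx⟩
      · exact (hx' ⟨w, rfl⟩).elim
      · exact (hp hx).elim)
    omega

end Join

/-! ### Pulling back independence; relations over self-sufficient sets -/

section

variable {L : FirstOrder.Language} [Fintype (Σ n, L.Relations n)]

theorem Indep.of_comp {M N I : Type*} [L.Structure M] [L.Structure N] {g : M ↪[L] N} {y : I → M}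
    (h : Indep L (g ∘ y)) : Indep L y := fun X => by
  have := h (X.map g.toEmbedding)
  rw [predim_map] at this
  refine le_trans (le_of_eq ?_) this
  congr 3
  ext i
  exact (Finset.mem_map' g.toEmbedding).symm

theorem indep_of_isEmpty {M I : Type*} [L.Structure M] [IsEmpty I] [IsEmpty (L.Relations 0)]
    {f : ℝ → ℝ} (hM : Admissible L f M) (y : I → M) : Indep L y := fun X => by
  rw [Set.eq_empty_of_isEmpty {i | y i ∈ X}, Set.ncard_empty]
  exact_mod_cast hM.predim_nonneg X

/-- Otherwise adjoining `y` would add one point and at least one relation, and so not raise the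
predimension. -/
theorem SelfSufficient.mem_of_relMap {M : Type*} [L.Structure M] {C : Finset M}
    (hC : SelfSufficient L (C : Set M)) {k : ℕ} {r : L.Relations k} {v : Fin k → M}
    (hv : RelMap r v) {y : M} {j : Fin k} (hj : v j = y) (h : ∀ i, v i = y ∨ v i ∈ C) : y ∈ C := by
  classical
  by_contra hy
  have h1 := hC.predim_lt (Finset.ssubset_insert hy)
  rw [predim_eq, predim_eq, Finset.card_insert_of_notMem hy] at h1
  have h2 : (relSet L (C : Set M)).ncard < (relSet L ((insert y C : Finset M) : Set M)).ncard := by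
    refine Set.ncard_lt_ncard ⟨relSet_mono (by simp), fun hsub => hy ?_⟩ (relSet_finite _)
    have h3 : (⟨⟨k, r⟩, v⟩ : Σ R : (Σ n, L.Relations n), (Fin R.1 → M)) ∈
        relSet L ((insert y C : Finset M) : Set M) :=
      ⟨hv, fun i => by simpa using h i⟩
    exact hj ▸ (hsub h3).2 j
  rw [Nat.cast_add, Nat.cast_one] at h1
  omega

theorem predim_le_card {M : Type*} [L.Structure M] (X : Finset M) : predim L X ≤ X.card := by
  rw [predim_eq]; omega

end

/-- A subset of a structure in a relational language, as a substructure. -/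
def substructureOf (L : FirstOrder.Language) [L.IsRelational] {M : Type*} [L.Structure M]
    (A : Set M) : L.Substructure M where
  carrier := A
  fun_mem := fun f => isEmptyElim f

/-! ### The generic structure: homogeneity and common points -/

namespace IsGeneric

universe w

variable {L : FirstOrder.Language} [Fintype (Σ n, L.Relations n)]
  [IsEmpty (L.Relations 0)] {f : ℝ → ℝ} {M : Type w} [L.Structure M] (hM : IsGeneric L f M)

include hM

theorem admissible : Admissible L f M := by
  classical
  obtain ⟨S, hS, hS', hcov⟩ := hM.chain
  have key : ∀ X : Finset M, ∃ k, ∃ Y : Finset (S k), Y.map (S k).subtype.toEmbedding = X := by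
    intro X
    have h1 : ∃ k, ∀ x ∈ X, x ∈ S k := by
      induction X using Finset.induction_on with
      | empty => exact ⟨0, by simp⟩
      | insert a X _ ih =>
        obtain ⟨k, hk⟩ := ih
        obtain ⟨l, hl⟩ := hcov a
        refine ⟨max k l, fun x hx => ?_⟩
        rcases Finset.mem_insert.1 hx with rfl | hx
        · exact hS (le_max_right _ _) hl
        · exact hS (le_max_left _ _) (hk x hx)
    obtain ⟨k, hk⟩ := h1
    refine ⟨k, X.preimage (S k).subtype (S k).subtype.injective.injOn, ?_⟩
    ext x
    simp only [Finset.mem_map, Finset.mem_preimage]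
    constructor
    · rintro ⟨y, hy, rfl⟩
      exact hy
    · exact fun hx => ⟨⟨x, hk x hx⟩, hx, rfl⟩
  refine ⟨fun X hX => ?_, fun X => ?_⟩
  · obtain ⟨k, Y, rfl⟩ := key X
    rw [predim_map]
    exact (inClass_iff.1 (hS' k).1).2.1 Y (by simpa using hX)
  · obtain ⟨k, Y, rfl⟩ := key X
    rw [predim_map, Finset.card_map]
    exact (inClass_iff.1 (hS' k).1).2.2 Y

theorem extend {D : Type*} [L.Structure D] [Finite D] {B : Type w} [L.Structure B]
    {h : D ↪[L] M} (hh : SelfSufficient L (Set.range h)) (hB : Finite B ∧ Admissible L f B)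
    {g : D ↪[L] B} (hg : SelfSufficient L (Set.range g)) :
    ∃ β : B ↪[L] M, SelfSufficient L (Set.range β) ∧ ∀ d, β (g d) = h d := by
  have hr : (h.toHom.range : Set M) = Set.range h := rfl
  obtain ⟨β, hβ, hβ'⟩ := hM.extension h.toHom.range (hr ▸ Set.finite_range h) (hr ▸ hh) B
    (inClass_iff.2 hB) (g.comp h.equivRange.symm.toEmbedding) (by
      have : Set.range (g.comp h.equivRange.symm.toEmbedding) = Set.range g :=
        h.equivRange.symm.surjective.range_comp g
      rwa [this])
  refine ⟨β, hβ, fun d => ?_⟩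
  have h1 := hβ' (h.equivRange d)
  change β (g (h.equivRange.symm (h.equivRange d))) = h d at h1
  rwa [show h.equivRange.symm (h.equivRange d) = d from h.equivRange.toEquiv.symm_apply_apply d] at h1

/-- A finite `M` could be joined to a copy of itself and an isolated point; embedding the result
back over the first copy would contradict injectivity. -/
theorem infinite [L.IsRelational] (R : L.Relations 3)
    (hf_mono : MonotoneOn f (Set.Ici 0))
    (hf_double : ∀ a : ℝ, 0 ≤ a → f (2 * a + 1) ≤ f a + 1) : Infinite M := by
  by_contra hinf
  rw [not_infinite_iff_finite] at hinf
  have ha := hM.admissible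
  have hy : Indep L (Empty.elim : Empty → M) := indep_of_isEmpty ha _
  obtain ⟨β, -, hβ⟩ := hM.extend (h := Embedding.refl L M)
    (by
      have : Set.range (Embedding.refl L M) = Set.univ := Set.range_id
      rw [this]
      exact selfSufficient_univ)
    ⟨inferInstance, Join.admissible (R := R) hf_mono hf_double ha ha hy hy⟩
    (Join.selfSufficient_inl ha hy)
  refine Join.inl_ne_pt R Empty.elim Empty.elim (β (Join.pt R _ _)) (β.injective ?_)
  exact hβ _

variable [L.IsRelational] (hf : Tendsto f atTop atTop)

include hf

/-- Finite partial isomorphisms between self-sufficient sets are elementary. -/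
theorem boundedFormula_realize_iff {γ : Type*} [Finite γ] {k : ℕ} (φ : L.BoundedFormula γ k) :
    ∀ {D : Type w} [L.Structure D] [Finite D] (g h : D ↪[L] M),
      SelfSufficient L (Set.range g) → SelfSufficient L (Set.range h) →
      ∀ (v : γ → D) (xs : Fin k → D), φ.Realize (g ∘ v) (g ∘ xs) ↔ φ.Realize (h ∘ v) (h ∘ xs) := by
  induction φ with
  | falsum => intros; rfl
  | equal t₁ t₂ =>
    intro D _ _ g h _ _ v xs
    simp only [BoundedFormula.Realize]
    rw [← Sum.comp_elim, ← Sum.comp_elim]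
    simp only [HomClass.realize_term, g.injective.eq_iff, h.injective.eq_iff]
  | rel r ts =>
    intro D _ _ g h _ _ v xs
    simp only [BoundedFormula.Realize]
    rw [← Sum.comp_elim, ← Sum.comp_elim]
    simp only [HomClass.realize_term]
    exact (g.map_rel r _).trans (h.map_rel r _).symm
  | imp φ ψ ih₁ ih₂ =>
    intro D _ _ g h hg hh v xs
    simp only [BoundedFormula.realize_imp, ih₁ g h hg hh, ih₂ g h hg hh]
  | all φ ih =>
    have key : ∀ {D : Type w} [L.Structure D] [Finite D] (g h : D ↪[L] M),
        SelfSufficient L (Set.range g) → SelfSufficient L (Set.range h) →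
        ∀ (v : γ → D) (xs), φ.all.Realize (g ∘ v) (g ∘ xs) → φ.all.Realize (h ∘ v) (h ∘ xs) := by
      intro D _ _ g h hg hh v xs hall
      simp only [BoundedFormula.realize_all] at hall ⊢
      intro m
      classical
      -- The "forth" step: close up the range of `h` together with `m`, and use the extension
      -- property to place this finite structure over `g` as well.
      obtain ⟨C, hC, -, hCs, -⟩ := hM.admissible.exists_closure hf
        (insert m (Set.finite_range h).toFinset)
      let E := substructureOf L (C : Set M)
      have hE : SelfSufficient L (Set.range E.subtype) := by
        have : Set.range E.subtype = (C : Set M) := Subtype.range_coe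
        rwa [this]
      have hDC : ∀ d, h d ∈ E := fun d =>
        hC (Finset.mem_insert_of_mem ((Set.finite_range h).mem_toFinset.2 ⟨d, rfl⟩))
      let i : D ↪[L] E := h.codRestrict E hDC
      have hi : SelfSufficient L (Set.range i) := by
        have : Set.range i = E.subtype ⁻¹' Set.range h := by
          ext x
          constructor
          · rintro ⟨d, rfl⟩
            exact ⟨d, rfl⟩
          · rintro ⟨d, hd⟩
            exact ⟨d, Subtype.ext hd⟩
        rw [this]
        exact hh.preimage
      have hfin : Finite E := C.finite_toSet.to_subtype
      obtain ⟨β, hβ, hβ'⟩ := hM.extend hg ⟨hfin, hM.admissible.of_embedding E.subtype⟩ hi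
      have hm : m ∈ E := hC (Finset.mem_insert_self _ _)
      have h1 := (ih β E.subtype hβ hE (i ∘ v) (Fin.snoc (i ∘ xs) ⟨m, hm⟩)).1
      rw [Fin.comp_snoc, Fin.comp_snoc, ← Function.comp_assoc, ← Function.comp_assoc,
        ← Function.comp_assoc, ← Function.comp_assoc, show β ∘ i = g from funext hβ',
        show E.subtype ∘ i = h from rfl] at h1
      exact h1 (hall _)
    intro D _ _ g h hg hh v xs
    exact ⟨key g h hg hh v xs, key h g hh hg v xs⟩

theorem realize_iff {γ : Type*} [Finite γ] (φ : L.Formula γ) {D : Type w} [L.Structure D]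
    [Finite D] {g h : D ↪[L] M} (hg : SelfSufficient L (Set.range g))
    (hh : SelfSufficient L (Set.range h)) (v : γ → D) :
    φ.Realize (g ∘ v) ↔ φ.Realize (h ∘ v) := by
  have := hM.boundedFormula_realize_iff hf φ g h hg hh v default
  simpa only [Formula.Realize, Subsingleton.elim (g ∘ default) (default : Fin 0 → M),
    Subsingleton.elim (h ∘ default) (default : Fin 0 → M)] using this

/-- Any finite subset of `M` is contained in a finite self-sufficient substructure. -/
theorem exists_substructure {γ : Type*} [Finite γ] (a : γ → M) : ∃ E : L.Substructure M,
    Finite E ∧ SelfSufficient L (Set.range E.subtype) ∧ ∀ i, a i ∈ E := by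
  obtain ⟨C, hC, -, hCs, -⟩ := hM.admissible.exists_closure hf (Set.finite_range a).toFinset
  refine ⟨substructureOf L (C : Set M), C.finite_toSet.to_subtype, ?_, fun i =>
    hC ((Set.finite_range a).mem_toFinset.2 ⟨i, rfl⟩)⟩
  have : Set.range (substructureOf L (C : Set M)).subtype = (C : Set M) := Subtype.range_coe
  rwa [this]

variable (R : L.Relations 3) (hf_mono : MonotoneOn f (Set.Ici 0))
    (hf_double : ∀ a : ℝ, 0 ≤ a → f (2 * a + 1) ≤ f a + 1)

include R hf_mono hf_double

theorem exists_indep_copies {n k : ℕ} (Φ : L.Formula (Fin n)) {a : Fin n → M} (ha : Φ.Realize a)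
    {s : Fin k → Fin n} (hs : Indep L (a ∘ s)) (m : ℕ) : ∃ b : Fin m → Fin n → M,
    (∀ i, Φ.Realize (b i)) ∧ Indep L (fun p : Fin m × Fin k => b p.1 (s p.2)) := by
  classical
  have hadm := hM.admissible
  induction m with
  | zero => exact ⟨fun i => i.elim0, fun i => i.elim0, indep_of_isEmpty hadm _⟩
  | succ m ih =>
    obtain ⟨b, hb, hbi⟩ := ih
    obtain ⟨C, hCf, hCs, hC⟩ := hM.exists_substructure hf (fun p : Fin m × Fin n => b p.1 p.2)
    obtain ⟨W, hWf, hWs, hW⟩ := hM.exists_substructure hf a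
    have hCa : Admissible L f C := hadm.of_embedding C.subtype
    have hWa : Admissible L f W := hadm.of_embedding W.subtype
    -- With an empty index type `Join` adds no relations: it is a free amalgam with a harmless
    -- isolated point, in which predimensions add up.
    have hy : Indep L (Empty.elim : Empty → C) := indep_of_isEmpty hCa _
    have hz : Indep L (Empty.elim : Empty → W) := indep_of_isEmpty hWa _
    obtain ⟨β, hβs, hβ⟩ := hM.extend hCs
      ⟨inferInstance, Join.admissible (R := R) hf_mono hf_double hCa hWa hy hz⟩
      (Join.selfSufficient_inl hWa hz)
    let a' : Fin n → W := fun j => ⟨a j, hW j⟩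
    let e : W ↪[L] M := β.comp (Join.inrEmb R Empty.elim Empty.elim)
    have he : SelfSufficient L (Set.range e) := (Join.selfSufficient_inr hCa hy).range_comp hβs
    refine ⟨Fin.snoc b (e ∘ a'), fun i => ?_, fun X => ?_⟩
    · refine Fin.lastCases ?_ (fun i => ?_) i
      · rw [Fin.snoc_last]
        exact (hM.realize_iff hf Φ hWs he a').1 ha
      · rw [Fin.snoc_castSucc]
        exact hb i
    · set Y := X.preimage β β.injective.injOn with hY
      have h1 : predim L Y ≤ predim L X := by
        have := hβs.filter_le X
        have e : X.filter (· ∈ Set.range β) = Y.map β.toEmbedding := by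
          ext x
          simp only [Finset.mem_filter, Set.mem_range, Finset.mem_map, hY, Finset.mem_preimage]
          constructor
          · rintro ⟨hx, c, rfl⟩
            exact ⟨c, hx, rfl⟩
          · rintro ⟨c, hx, rfl⟩
            exact ⟨hx, c, rfl⟩
        rwa [e, predim_map] at this
      have h2 := Join.le_predim R Empty.elim Empty.elim Y
      rw [Set.eq_empty_of_isEmpty {i : Empty | _}, Set.ncard_empty] at h2
      have h3 : Indep L (fun p : Fin m × Fin k => (⟨b p.1 (s p.2), hC (p.1, s p.2)⟩ : C)) :=
        Indep.of_comp (g := C.subtype) hbi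
      have h4 : Indep L (a' ∘ s) := Indep.of_comp (g := W.subtype) hs
      have h5 := h3 (Join.left R Empty.elim Empty.elim Y)
      have h6 := h4 (Join.right R Empty.elim Empty.elim Y)
      have h7 : {p : Fin (m + 1) × Fin k |
          (Fin.snoc b (e ∘ a') : Fin (m + 1) → Fin n → M) p.1 (s p.2) ∈ X} ⊆
          ((fun p : Fin m × Fin k => (p.1.castSucc, p.2)) ''
            {p | (⟨b p.1 (s p.2), hC (p.1, s p.2)⟩ : C) ∈ Join.left R Empty.elim Empty.elim Y}) ∪
          (fun j => (Fin.last m, j)) ''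
            {j | (a' ∘ s) j ∈ Join.right R Empty.elim Empty.elim Y} := by
        rintro ⟨i, j⟩ hp
        induction i using Fin.lastCases with
        | last =>
          rw [Set.mem_ofPred_eq, Fin.snoc_last] at hp
          exact Or.inr ⟨j, Finset.mem_preimage.2 (Finset.mem_preimage.2 hp), rfl⟩
        | cast i =>
          rw [Set.mem_ofPred_eq, Fin.snoc_castSucc] at hp
          refine Or.inl ⟨(i, j), Finset.mem_preimage.2 (Finset.mem_preimage.2 ?_), rfl⟩
          have := hβ ⟨b i (s j), hC (i, s j)⟩
          exact this.symm ▸ hp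
      have h8 := (Set.ncard_le_ncard h7).trans (Set.ncard_union_le _ _)
      have h9 := Set.ncard_image_le (f := fun p : Fin m × Fin k => (p.1.castSucc, p.2)) (s :=
        {p | (⟨b p.1 (s p.2), hC (p.1, s p.2)⟩ : C) ∈ Join.left R Empty.elim Empty.elim Y})
      have h10 := Set.ncard_image_le (f := fun j => (Fin.last m, j))
        (s := {j | (a' ∘ s) j ∈ Join.right R Empty.elim Empty.elim Y})
      beta_reduce at h5 h6 ⊢
      split_ifs at h2 <;> omega

/-- Both `y` and the basis coordinates of `m` independent copies of `a` are independent, so the join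
along all pairs embeds over a self-sufficient set containing `y`. The copies move, but to another
self-sufficient position, where `Φ` still holds. -/
theorem exists_common_point {n k m : ℕ} (Φ : L.Formula (Fin n)) {a : Fin n → M} (ha : Φ.Realize a)
    {s : Fin k → Fin n} (hs : Indep L (a ∘ s)) {y : Fin m × Fin k → M} (hy : Indep L y) :
    ∃ x : M, ∃ b : Fin m → Fin n → M, (∀ i, Φ.Realize (b i)) ∧
      ∀ i j, RelMap R ![x, y (i, j), b i (s j)] := by
  have hadm := hM.admissible
  obtain ⟨b, hb, hbi⟩ := hM.exists_indep_copies hf R hf_mono hf_double Φ ha hs m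
  obtain ⟨C, hCf, hCs, hC⟩ := hM.exists_substructure hf y
  obtain ⟨W, hWf, hWs, hW⟩ := hM.exists_substructure hf (fun p : Fin m × Fin n => b p.1 p.2)
  have hCa : Admissible L f C := hadm.of_embedding C.subtype
  have hWa : Admissible L f W := hadm.of_embedding W.subtype
  let y' : Fin m × Fin k → C := fun p => ⟨y p, hC p⟩
  let z' : Fin m × Fin k → W := fun p => ⟨b p.1 (s p.2), hW (p.1, s p.2)⟩
  have hy' : Indep L y' := Indep.of_comp (g := C.subtype) hy
  have hz' : Indep L z' := Indep.of_comp (g := W.subtype) hbi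
  obtain ⟨β, hβs, hβ⟩ := hM.extend hCs
    ⟨inferInstance, Join.admissible (R := R) hf_mono hf_double hCa hWa hy' hz'⟩
    (Join.selfSufficient_inl hWa hz')
  let e : W ↪[L] M := β.comp (Join.inrEmb R y' z')
  have he : SelfSufficient L (Set.range e) := (Join.selfSufficient_inr hCa hy').range_comp hβs
  refine ⟨β (Join.pt R y' z'), fun i => e ∘ fun j => ⟨b i j, hW (i, j)⟩, fun i => ?_, fun i j => ?_⟩
  · exact (hM.realize_iff hf Φ hWs he fun j => ⟨b i j, hW (i, j)⟩).1 (hb i)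
  · have h1 := (β.map_rel R _).2 (Join.relMap_new R y' z' (i, j))
    convert h1 using 1
    have h2 := hβ (y' (i, j))
    funext l
    fin_cases l
    · rfl
    · exact h2.symm
    · rfl

end IsGeneric

theorem ncard_image_eq_of_iff {X Y Z : Type*} {T : Set X} {p : X → Y} {q : X → Z}
    (h : ∀ x ∈ T, ∀ x' ∈ T, p x = p x' ↔ q x = q x') : (p '' T).ncard = (q '' T).ncard := by
  refine Set.ncard_congr (fun _ hy => q hy.choose) (fun _ hy => ⟨_, hy.choose_spec.1, rfl⟩)
    (fun y y' hy hy' e => ?_) ?_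
  · rw [← hy.choose_spec.2, ← hy'.choose_spec.2]
    exact (h _ hy.choose_spec.1 _ hy'.choose_spec.1).2 e
  · rintro _ ⟨x, hx, rfl⟩
    have hy : p x ∈ p '' T := ⟨x, hx, rfl⟩
    exact ⟨p x, hy, (h _ hy.choose_spec.1 _ hx).1 hy.choose_spec.2⟩

/-! ### Quantifier-free types and definability of dimension -/

section Diagram

variable {L : FirstOrder.Language} {M : Type*} [L.Structure M] {α : Type*}

/-- The data of the quantifier-free type of a family of elements. -/
abbrev Diagram (L : FirstOrder.Language) (α : Type*) : Type _ :=
  (α → α → Prop) × (∀ R : (Σ n, L.Relations n), (Fin R.1 → α) → Prop)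

/-- The quantifier-free type of a family of elements. -/
def diagram (L : FirstOrder.Language) {M : Type*} [L.Structure M] {α : Type*} (v : α → M) :
    Diagram L α :=
  (fun i j => v i = v j, fun R g => RelMap R.2 (v ∘ g))

theorem definable_of_iff {P : Prop} {s : Set (α → M)} (hs : (∅ : Set M).Definable L s) :
    (∅ : Set M).Definable L {v | v ∈ s ↔ P} := by
  by_cases hP : P
  · simpa [hP] using hs
  · simpa [hP, Set.compl_def] using hs.compl

theorem definable_eq (i j : α) : (∅ : Set M).Definable L {v : α → M | v i = v j} := by
  refine Set.empty_definable_iff.2 ⟨(Term.var i).equal (Term.var j), ?_⟩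
  ext v
  simp [Formula.realize_equal]

theorem definable_relMap {k : ℕ} (r : L.Relations k) (g : Fin k → α) :
    (∅ : Set M).Definable L {v : α → M | RelMap r (v ∘ g)} := by
  refine Set.empty_definable_iff.2 ⟨r.formula fun i => Term.var (g i), ?_⟩
  ext v
  simp [Formula.realize_rel, Function.comp_def]

variable [Finite α] [Finite (Σ n, L.Relations n)]

theorem definable_diagram_eq (D : Diagram L α) :
    (∅ : Set M).Definable L {v : α → M | diagram L v = D} := by
  have : {v : α → M | diagram L v = D} =
      (⋂ i, ⋂ j, {v : α → M | v ∈ {v : α → M | v i = v j} ↔ D.1 i j}) ∩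
        ⋂ R, ⋂ g, {v : α → M | v ∈ {v : α → M | RelMap R.2 (v ∘ g)} ↔ D.2 R g} := by
    ext v
    simp only [diagram, Prod.ext_iff, funext_iff, Set.mem_ofPred_eq, Set.mem_inter_iff,
      Set.mem_iInter, eq_iff_iff]
  rw [this]
  exact (Set.definable_iInter_of_finite fun i => Set.definable_iInter_of_finite fun j =>
    definable_of_iff (definable_eq i j)).inter (Set.definable_iInter_of_finite fun R =>
      Set.definable_iInter_of_finite fun g => definable_of_iff (definable_relMap R.2 g))

/-- Finitely many variables and symbols leave only finitely many diagrams. -/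
theorem definable_of_diagram {s : Set (α → M)}
    (h : ∀ v w, diagram L v = diagram L w → v ∈ s → w ∈ s) : (∅ : Set M).Definable L s := by
  have : s = ⋃ D : {D : Diagram L α // ∃ v ∈ s, diagram L v = D},
      {v : α → M | diagram L v = D} := by
    ext w
    simp only [Set.mem_iUnion, Set.mem_ofPred_eq]
    constructor
    · exact fun hw => ⟨⟨_, w, hw, rfl⟩, rfl⟩
    · rintro ⟨⟨_, v, hv, rfl⟩, e⟩
      exact h v w e.symm hv
  rw [this]
  exact Set.definable_iUnion_of_finite fun D => definable_diagram_eq D.1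

end Diagram

section Definability

variable {L : FirstOrder.Language} [Fintype (Σ n, L.Relations n)] {M : Type*} [L.Structure M]

open scoped Classical in
theorem predim_image_eq_of_diagram {α : Type*} [Fintype α] {v w : α → M}
    (h : diagram L v = diagram L w) :
    predim L (Finset.univ.image v) = predim L (Finset.univ.image w) := by
  have h1 : ∀ i j, v i = v j ↔ w i = w j := fun i j =>
    iff_of_eq (congrFun (congrFun (congrArg Prod.fst h) i) j)
  have h2 : ∀ (R : Σ n, L.Relations n) (g : Fin R.1 → α),
      RelMap R.2 (v ∘ g) ↔ RelMap R.2 (w ∘ g) := fun R g =>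
    iff_of_eq (congrFun (congrFun (congrArg Prod.snd h) R) g)
  let T : Set (Σ R : (Σ n, L.Relations n), (Fin R.1 → α)) := {p | RelMap p.1.2 (v ∘ p.2)}
  have key : ∀ u : α → M, (∀ (R : Σ n, L.Relations n) (g : Fin R.1 → α),
      RelMap R.2 (v ∘ g) ↔ RelMap R.2 (u ∘ g)) →
      relSet L ((Finset.univ.image u : Finset M) : Set M) =
        (fun p : Σ R : (Σ n, L.Relations n), (Fin R.1 → α) =>
          (⟨p.1, u ∘ p.2⟩ : Σ R : (Σ n, L.Relations n), (Fin R.1 → M))) '' T := by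
    intro u hu
    ext ⟨R, x⟩
    constructor
    · rintro ⟨hx, hx'⟩
      have : ∀ i, ∃ a, u a = x i := fun i => by simpa using hx' i
      choose g hg using this
      obtain rfl : u ∘ g = x := funext hg
      exact ⟨⟨R, g⟩, (hu R g).2 hx, rfl⟩
    · rintro ⟨⟨R', g⟩, hg, e⟩
      cases e
      exact ⟨(hu _ g).1 hg, fun i => by simp⟩
  have h3 : (Finset.univ.image v).card = (Finset.univ.image w).card := by
    rw [← Set.ncard_coe_finset, ← Set.ncard_coe_finset, Finset.coe_image, Finset.coe_image]
    exact ncard_image_eq_of_iff fun i _ j _ => h1 i j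
  rw [predim_eq, predim_eq, h3, key v fun _ _ => Iff.rfl, key w h2]
  congr 2
  refine ncard_image_eq_of_iff ?_
  rintro ⟨R, g⟩ - ⟨R', g'⟩ -
  by_cases hR : R = R'
  · subst hR
    simp only [Sigma.mk.injEq, heq_eq_eq, true_and, funext_iff, Function.comp_apply, h1]
  · simp [hR]

open scoped Classical in
-- A set witnessing `d ≤ r` has at most `K` elements, so it can be quantified over as a tuple of one
-- of finitely many lengths.
theorem Admissible.definable_setDim_le [IsEmpty (L.Relations 0)] {f : ℝ → ℝ}
    (hf : Tendsto f atTop atTop) (hM : Admissible L f M) {γ : Type*} [Fintype γ] (r : ℤ) :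
    (∅ : Set M).Definable L {a : γ → M | setDim L (Finset.univ.image a) ≤ r} := by
  obtain ⟨K, hK⟩ := hM.exists_card_le hf r
  have : {a : γ → M | setDim L (Finset.univ.image a) ≤ r} =
      ⋃ l : Fin (K + 1), (fun v : γ ⊕ Fin l → M => v ∘ Sum.inl) ''
        {v | predim L (Finset.univ.image v) ≤ r} := by
    ext a
    simp only [Set.mem_ofPred_eq, Set.mem_iUnion, Set.mem_image]
    rw [hM.setDim_le_iff]
    constructor
    · rintro ⟨Y, hY, hr⟩
      let e := Y.equivFin.symm
      refine ⟨⟨Y.card, Nat.lt_succ_of_le (hK Y hr)⟩, Sum.elim a fun i => e i, ?_, rfl⟩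
      convert hr
      ext x
      simp only [Finset.mem_image, Finset.mem_univ, true_and, Sum.exists, Sum.elim_inl,
        Sum.elim_inr]
      constructor
      · rintro (⟨i, rfl⟩ | ⟨i, rfl⟩)
        · exact hY (by simp)
        · exact (e i).2
      · exact fun hx => Or.inr ⟨e.symm ⟨x, hx⟩, by simp⟩
    · rintro ⟨l, v, hv, rfl⟩
      refine ⟨_, ?_, hv⟩
      intro x
      simp only [Finset.mem_image, Finset.mem_univ, true_and, Function.comp_apply]
      rintro ⟨i, rfl⟩
      exact ⟨_, rfl⟩
  rw [this]
  refine Set.definable_iUnion_of_finite fun l => Set.Definable.image_comp ?_ _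
  refine definable_of_diagram fun v w h hv => ?_
  rw [Set.mem_ofPred_eq] at hv ⊢
  rwa [← predim_image_eq_of_diagram h]

end Definability

/-! ### Transfer to the finite structures -/

section Transfer

variable {L : FirstOrder.Language} {M : Type*} [L.Structure M] {ι : Type*} {U : Ultrafilter ι}
  {F : ι → Type*} [∀ i, L.Structure (F i)] [∀ i, Nonempty (F i)]
  (h_psf : M ≅[L] (U : Filter ι).Product F)

include h_psf

theorem transfer_forall {α : Type*} [Finite α] {φ : L.Formula α} (h : ∀ v : α → M, φ.Realize v) :
    ∀ᶠ i in U, ∀ v : α → F i, φ.Realize v := by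
  let σ : L.Sentence := (φ.relabel (Sum.inr : α → Empty ⊕ α)).iAlls α
  have h1 : M ⊨ σ := by
    simpa only [σ, Sentence.Realize, Formula.realize_iAlls, Formula.realize_relabel,
      Sum.elim_comp_inr] using h
  refine ((Ultraproduct.sentence_realize σ).1 ((elementarilyEquivalent_iff.1 h_psf σ).1 h1)).mono
    fun i hi => ?_
  simpa only [σ, Sentence.Realize, Formula.realize_iAlls, Formula.realize_relabel,
    Sum.elim_comp_inr] using hi

theorem transfer_exists {α : Type*} [Finite α] {φ : L.Formula α} (h : ∃ v : α → M, φ.Realize v) :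
    ∀ᶠ i in U, ∃ v : α → F i, φ.Realize v := by
  let σ : L.Sentence := (φ.relabel (Sum.inr : α → Empty ⊕ α)).iExs α
  have h1 : M ⊨ σ := by
    simpa only [σ, Sentence.Realize, Formula.realize_iExs, Formula.realize_relabel,
      Sum.elim_comp_inr] using h
  refine ((Ultraproduct.sentence_realize σ).1 ((elementarilyEquivalent_iff.1 h_psf σ).1 h1)).mono
    fun i hi => ?_
  simpa only [σ, Sentence.Realize, Formula.realize_iExs, Formula.realize_relabel,
    Sum.elim_comp_inr] using hi

/-- The bound is a universal sentence: among `K + 1` realisations with the same `σ`-coordinates, two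
coincide. Finiteness in `M` is a separate condition because `ncard` is `0` on infinite sets. -/
theorem transfer_fiber {α β : Type*} [Finite α] [Finite β] {φ : L.Formula α} {σ : β → α} {K : ℕ}
    (h : ∀ b : β → M, {a : α → M | φ.Realize a ∧ a ∘ σ = b}.Finite ∧
      {a : α → M | φ.Realize a ∧ a ∘ σ = b}.ncard ≤ K) [∀ i, Finite (F i)] :
    ∀ᶠ i in U, ∀ b : β → F i, {a : α → F i | φ.Realize a ∧ a ∘ σ = b}.ncard ≤ K := by
  let ψ : L.Formula (Fin (K + 1) × α) :=
    (Formula.iInf (fun j : Fin (K + 1) => φ.relabel (fun t => (j, t))) ⊓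
      Formula.iInf (fun p : Fin (K + 1) × β =>
        (Term.var (p.1, σ p.2)).equal (Term.var (0, σ p.2)))).imp
    (Formula.iSup (fun p : {p : Fin (K + 1) × Fin (K + 1) // p.1 ≠ p.2} =>
      Formula.iInf (fun t : α => (Term.var (p.1.1, t)).equal (Term.var (p.1.2, t)))))
  have hψM : ∀ v : Fin (K + 1) × α → M, ψ.Realize v := by
    intro v
    simp only [ψ, Formula.realize_imp, Formula.realize_inf, Formula.realize_iInf,
      Formula.realize_relabel, Formula.realize_equal, Term.realize_var, Formula.realize_iSup]
    rintro ⟨h1, h2⟩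
    by_contra! hne
    obtain ⟨hfin, hcard⟩ := h fun s => v (0, σ s)
    let g : Fin (K + 1) → {a : α → M | φ.Realize a ∧ a ∘ σ = fun s => v (0, σ s)} :=
      fun j => ⟨fun t => v (j, t), h1 j, funext fun s => h2 (j, s)⟩
    have hg : Function.Injective g := by
      intro j j' e
      by_contra hj
      obtain ⟨t, ht⟩ := hne ⟨(j, j'), hj⟩
      exact ht (congrFun (congrArg Subtype.val e) t)
    have := hfin.to_subtype
    have h3 := Nat.card_le_card_of_injective g hg
    rw [Nat.card_fin, Nat.card_coe_set_eq] at h3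
    omega
  refine (transfer_forall h_psf hψM).mono fun i hi b => ?_
  by_contra! hlt
  have h1 : Nonempty (Fin (K + 1) ↪ {a : α → F i | φ.Realize a ∧ a ∘ σ = b}) := by
    have := Fintype.ofFinite {a : α → F i | φ.Realize a ∧ a ∘ σ = b}
    refine Function.Embedding.nonempty_of_card_le ?_
    rw [Fintype.card_fin, ← Nat.card_eq_fintype_card, Nat.card_coe_set_eq]
    exact hlt
  obtain ⟨g⟩ := h1
  have h2 := hi fun p => (g p.1).1 p.2
  simp only [ψ, Formula.realize_imp, Formula.realize_inf, Formula.realize_iInf,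
    Formula.realize_relabel, Formula.realize_equal, Term.realize_var, Formula.realize_iSup] at h2
  obtain ⟨⟨⟨j, j'⟩, hj⟩, he⟩ := h2 ⟨fun j => (g j).2.1, fun p => by
    have e1 := congrFun (g p.1).2.2 p.2
    have e2 := congrFun (g 0).2.2 p.2
    exact e1.trans e2.symm⟩
  exact hj (g.injective (Subtype.ext (funext he)))

end Transfer

/-! ### Counting in a finite structure -/

section Counting

theorem ncard_le_of_fiber {X Y : Type*} [Finite X] [Finite Y] {T : Set X} {p : X → Y} {K : ℕ}
    (h : ∀ b, {a | a ∈ T ∧ p a = b}.ncard ≤ K) : T.ncard ≤ K * Nat.card Y := by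
  classical
  have := Fintype.ofFinite X
  have := Fintype.ofFinite Y
  rw [Set.ncard_eq_toFinset_card', Nat.card_eq_fintype_card, ← Finset.card_univ]
  refine Finset.card_le_mul_card_image_of_maps_to (f := p) (fun _ _ => Finset.mem_univ _) K fun b _ => ?_
  refine le_trans (le_of_eq ?_) (h b)
  rw [← Set.ncard_coe_finset]
  congr 1
  ext a
  simp

theorem pow_le_of_common_point {F : Type*} [Finite F] [Nonempty F] {n k m K C : ℕ}
    {Q : F → F → F → Prop} (hQ : ∀ x z, {y | Q x y z}.ncard ≤ K) {P : Set (Fin n → F)}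
    {s : Fin k → Fin n} {bad : Set (Fin m × Fin k → F)}
    (hbad : bad.ncard * Nat.card F ≤ C * Nat.card F ^ (m * k)) (hC : 2 * C ≤ Nat.card F)
    (h : ∀ y ∉ bad, ∃ x, ∃ b : Fin m → Fin n → F, (∀ i, b i ∈ P) ∧
      ∀ i j, Q x (y (i, j)) (b i (s j))) :
    Nat.card F ^ (m * k) ≤ 2 * (Nat.card F * (P.ncard * K ^ k) ^ m) := by
  classical
  have := Fintype.ofFinite F
  -- `E x` collects the possible blocks `y (i, ·)` for a given `x`; a good `y` consists of `m`
  -- blocks from the same `E x`.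
  let E : F → Finset (Fin k → F) := fun x => P.toFinset.biUnion fun a =>
    Fintype.piFinset fun j => Finset.univ.filter fun y => Q x y (a (s j))
  have hE : ∀ x, (E x).card ≤ P.ncard * K ^ k := by
    intro x
    rw [Set.ncard_eq_toFinset_card']
    refine Finset.card_biUnion_le_card_mul _ _ _ fun a _ => ?_
    rw [Fintype.card_piFinset]
    refine (Finset.prod_le_pow_card _ _ K fun j _ => ?_).trans_eq (by simp)
    refine le_trans (le_of_eq ?_) (hQ x (a (s j)))
    rw [← Set.ncard_coe_finset]
    congr 1
    ext y
    simp
  let G : F → Finset (Fin m × Fin k → F) := fun x =>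
    (Fintype.piFinset fun _ : Fin m => E x).image fun u p => u p.1 p.2
  have hG : ∀ x, (G x).card ≤ (P.ncard * K ^ k) ^ m := by
    intro x
    refine Finset.card_image_le.trans ?_
    rw [Fintype.card_piFinset]
    simpa using Nat.pow_le_pow_left (hE x) m
  have hcov : (Finset.univ : Finset (Fin m × Fin k → F)) ⊆
      bad.toFinset ∪ Finset.univ.biUnion G := by
    intro y _
    by_cases hy : y ∈ bad
    · exact Finset.mem_union_left _ (by simpa using hy)
    · obtain ⟨x, b, hb, hR⟩ := h y hy
      refine Finset.mem_union_right _ (Finset.mem_biUnion.2 ⟨x, Finset.mem_univ _,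
        Finset.mem_image.2 ⟨fun i j => y (i, j), Fintype.mem_piFinset.2 fun i => ?_, rfl⟩⟩)
      refine Finset.mem_biUnion.2 ⟨b i, by simpa using hb i, Fintype.mem_piFinset.2 fun j => ?_⟩
      simpa using hR i j
  have h1 := (Finset.card_le_card hcov).trans (Finset.card_union_le _ _)
  have h2 : (Finset.univ.biUnion G).card ≤ Nat.card F * (P.ncard * K ^ k) ^ m := by
    refine (Finset.card_biUnion_le_card_mul _ _ _ fun x _ => hG x).trans_eq ?_
    rw [Finset.card_univ, Nat.card_eq_fintype_card]
  have h3 : (Finset.univ : Finset (Fin m × Fin k → F)).card = Nat.card F ^ (m * k) := by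
    rw [Finset.card_univ, Nat.card_eq_fintype_card]
    simp
  rw [h3, ← Set.ncard_eq_toFinset_card'] at h1
  have hN : 0 < Nat.card F := Nat.card_pos
  -- Bad families are at most half of all families, which accounts for the factor `2` in the
  -- conclusion.
  have h4 : 2 * bad.ncard ≤ Nat.card F ^ (m * k) := by
    refine Nat.le_of_mul_le_mul_right (c := Nat.card F) ?_ hN
    calc 2 * bad.ncard * Nat.card F = 2 * (bad.ncard * Nat.card F) := by ring
      _ ≤ 2 * (C * Nat.card F ^ (m * k)) := by gcongr
      _ = (2 * C) * Nat.card F ^ (m * k) := by ring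
      _ ≤ Nat.card F * Nat.card F ^ (m * k) := by gcongr
      _ = _ := by ring
  omega

end Counting

/-! ### Uniform fibres and the counting inequalities -/

section

variable {L : FirstOrder.Language} [Fintype (Σ n, L.Relations n)] [IsEmpty (L.Relations 0)]
  {M : Type*} [L.Structure M] {f : ℝ → ℝ} (hf : Tendsto f atTop atTop) (hM : Admissible L f M)

include hf hM

open scoped Classical in
-- `Ψ` says that the whole tuple has dimension at most `S.card` and its `S`-part at least that. The
-- tuple then lies in the closure of its `S`-part, which has at most `K` points.
theorem Admissible.exists_formula_fiber {γ : Type*} [Fintype γ] (S : Finset γ) :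
    ∃ (Ψ : L.Formula γ) (K : ℕ),
      (∀ a : γ → M, setDim L (Finset.univ.image a) = S.card → setDim L (S.image a) = S.card →
        Ψ.Realize a) ∧
      ∀ b : S → M, {a : γ → M | Ψ.Realize a ∧ a ∘ (Subtype.val : S → γ) = b}.Finite ∧
        {a : γ → M | Ψ.Realize a ∧ a ∘ (Subtype.val : S → γ) = b}.ncard ≤ K := by
  obtain ⟨φ₁, h₁⟩ := Set.empty_definable_iff.1
    (hM.definable_setDim_le hf (γ := γ) (S.card : ℤ))
  obtain ⟨φ₂, h₂⟩ := Set.empty_definable_iff.1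
    (hM.definable_setDim_le hf (γ := S) ((S.card : ℤ) - 1))
  replace h₁ : ∀ a : γ → M, φ₁.Realize a ↔ setDim L (Finset.univ.image a) ≤ S.card := fun a =>
    (Set.ext_iff.1 h₁ a).symm
  replace h₂ : ∀ a : S → M, φ₂.Realize a ↔ setDim L (Finset.univ.image a) ≤ (S.card : ℤ) - 1 :=
    fun a => (Set.ext_iff.1 h₂ a).symm
  obtain ⟨K, hK⟩ := hM.exists_card_le hf (S.card : ℤ)
  have himg : ∀ a : γ → M, Finset.univ.image (a ∘ (Subtype.val : S → γ)) = S.image a := by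
    intro a
    ext x
    simp
  refine ⟨φ₁ ⊓ (φ₂.relabel Subtype.val).not, K ^ Fintype.card γ, fun a ha ha' => ?_, fun b => ?_⟩
  · rw [Formula.realize_inf, Formula.realize_not, Formula.realize_relabel, h₁, h₂, himg]
    omega
  · obtain ⟨C, hbC, hCe, -, hC⟩ := hM.exists_closure hf (Finset.univ.image b)
    have hCK : C.card ≤ K := by
      refine hK C ?_
      have h1 := hM.setDim_le (subset_refl (Finset.univ.image b))
      have h2 := predim_le_card (L := L) (Finset.univ.image b)
      have h3 : (Finset.univ.image b).card ≤ S.card :=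
        Finset.card_image_le.trans_eq (by simp)
      omega
    have hsub : {a : γ → M | (φ₁ ⊓ (φ₂.relabel Subtype.val).not).Realize a ∧
        a ∘ (Subtype.val : S → γ) = b} ⊆ (Fintype.piFinset fun _ : γ => C : Finset (γ → M)) := by
      rintro a ⟨ha, rfl⟩
      rw [Formula.realize_inf, Formula.realize_not, Formula.realize_relabel, h₁, h₂] at ha
      obtain ⟨D, hD, hDe⟩ := hM.exists_setDim_eq (Finset.univ.image a)
      have hDC : D ⊆ C := by
        refine hC D (Finset.Subset.trans ?_ hD) (by omega)
        rw [himg]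
        exact Finset.image_subset_image (Finset.subset_univ _)
      rw [Finset.mem_coe, Fintype.mem_piFinset]
      exact fun i => hDC (hD (Finset.mem_image_of_mem _ (Finset.mem_univ i)))
    refine ⟨(Finset.finite_toSet _).subset hsub, ?_⟩
    refine (Set.ncard_le_ncard hsub (Finset.finite_toSet _)).trans ?_
    rw [Set.ncard_coe_finset, Fintype.card_piFinset]
    simpa using Nat.pow_le_pow_left hCK _

/-- The middle coordinate lies in the closure of the outer two by `SelfSufficient.mem_of_relMap`,
and that closure has predimension at most `2`. -/
theorem Admissible.exists_relMap_fiber (R : L.Relations 3) : ∃ K : ℕ, ∀ b : Fin 2 → M,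
    {v : Fin 3 → M | (R.formula (Term.var : Fin 3 → L.Term (Fin 3))).Realize v ∧
      v ∘ ![0, 2] = b}.Finite ∧
    {v : Fin 3 → M | (R.formula (Term.var : Fin 3 → L.Term (Fin 3))).Realize v ∧
      v ∘ ![0, 2] = b}.ncard ≤ K := by
  classical
  obtain ⟨K, hK⟩ := hM.exists_card_le hf 2
  refine ⟨K ^ 3, fun b => ?_⟩
  obtain ⟨C, hbC, hCe, hCs, hC⟩ := hM.exists_closure hf (Finset.univ.image b)
  have hCK : C.card ≤ K := by
    refine hK C ?_
    have h1 := hM.setDim_le (subset_refl (Finset.univ.image b))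
    have h2 := predim_le_card (L := L) (Finset.univ.image b)
    have h3 : (Finset.univ.image b).card ≤ 2 := Finset.card_image_le.trans_eq (by simp)
    omega
  have hsub : {v : Fin 3 → M | (R.formula (Term.var : Fin 3 → L.Term (Fin 3))).Realize v ∧
      v ∘ ![0, 2] = b} ⊆ (Fintype.piFinset fun _ : Fin 3 => C : Finset (Fin 3 → M)) := by
    rintro v ⟨hv, rfl⟩
    rw [Formula.realize_rel] at hv
    have h0 : v 0 ∈ C := hbC (Finset.mem_image.2 ⟨0, Finset.mem_univ _, rfl⟩)
    have h2 : v 2 ∈ C := hbC (Finset.mem_image.2 ⟨1, Finset.mem_univ _, rfl⟩)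
    have h1 : v 1 ∈ C := hCs.mem_of_relMap (v := v) hv (j := 1) rfl fun i => by
      fin_cases i
      · exact Or.inr h0
      · exact Or.inl rfl
      · exact Or.inr h2
    rw [Finset.mem_coe, Fintype.mem_piFinset]
    intro i
    fin_cases i
    · exact h0
    · exact h1
    · exact h2
  refine ⟨(Finset.finite_toSet _).subset hsub, ?_⟩
  refine (Set.ncard_le_ncard hsub (Finset.finite_toSet _)).trans ?_
  rw [Set.ncard_coe_finset, Fintype.card_piFinset]
  simpa using Nat.pow_le_pow_left hCK 3

variable {ι : Type*} {U : Ultrafilter ι} {F : ι → Type*} [∀ i, L.Structure (F i)]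
  [∀ i, Nonempty (F i)] [∀ i, Finite (F i)] (h_psf : M ≅[L] (U : Filter ι).Product F)

include h_psf

open scoped Classical in
-- Every realisation has a basis among its coordinates with fewer than `r` members. The extra factor
-- `Nat.card (F i)` avoids the exponent `r - 1`, so that `r = 0` needs no separate treatment.
theorem Admissible.exists_ncard_mul_le {γ : Type*} [Fintype γ] {Φ : L.Formula γ} {r : ℕ}
    (h : ∀ a : γ → M, Φ.Realize a → setDim L (Finset.univ.image a) < r) :
    ∃ C : ℕ, ∀ᶠ i in U,
      {v : γ → F i | Φ.Realize v}.ncard * Nat.card (F i) ≤ C * Nat.card (F i) ^ r := by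
  choose Ψ K hΨ hK using fun S : Finset γ => hM.exists_formula_fiber hf S
  let T := {S : Finset γ // S.card < r}
  have h1 : ∀ a : γ → M, (Φ.imp (Formula.iSup fun S : T => Ψ S.1)).Realize a := by
    intro a
    rw [Formula.realize_imp, Formula.realize_iSup]
    intro ha
    obtain ⟨S, -, hS, hSe⟩ := hM.exists_basis a hf Finset.univ
    have h2 := h a ha
    exact ⟨⟨S, by omega⟩, hΨ S a (by omega) hS.symm⟩
  refine ⟨∑ S : T, K S.1, ?_⟩
  have h2 : ∀ᶠ i in U, ∀ S : T, ∀ b : S.1 → F i,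
      {a : γ → F i | (Ψ S.1).Realize a ∧ a ∘ (Subtype.val : S.1 → γ) = b}.ncard ≤ K S.1 :=
    eventually_all.2 fun S => transfer_fiber h_psf (hK S.1)
  filter_upwards [transfer_forall h_psf h1, h2] with i hi1 hi2
  have h3 : {v : γ → F i | Φ.Realize v} ⊆ ⋃ S : T, {v | (Ψ S.1).Realize v} := by
    intro v hv
    have := hi1 v
    rw [Formula.realize_imp, Formula.realize_iSup] at this
    exact Set.mem_iUnion.2 (this hv)
  have h4 : {v : γ → F i | Φ.Realize v}.ncard ≤ ∑ S : T, K S.1 * Nat.card (F i) ^ S.1.card := by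
    refine (Set.ncard_le_ncard h3).trans ?_
    have h5 : (⋃ S : T, {v : γ → F i | (Ψ S.1).Realize v}).ncard ≤
        ∑ S : T, {v : γ → F i | (Ψ S.1).Realize v}.ncard := by
      have := Fintype.ofFinite (F i)
      simp only [Set.ncard_eq_toFinset_card']
      refine le_trans (Finset.card_le_card ?_) Finset.card_biUnion_le
      intro v hv
      simpa using hv
    refine h5.trans (Finset.sum_le_sum fun S _ => ?_)
    refine (ncard_le_of_fiber (p := fun a => a ∘ (Subtype.val : S.1 → γ)) (hi2 S)).trans_eq ?_
    rw [Nat.card_fun]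
    simp
  have hN : 0 < Nat.card (F i) := Nat.card_pos
  calc {v : γ → F i | Φ.Realize v}.ncard * Nat.card (F i)
      ≤ (∑ S : T, K S.1 * Nat.card (F i) ^ S.1.card) * Nat.card (F i) := by gcongr
    _ = ∑ S : T, K S.1 * Nat.card (F i) ^ (S.1.card + 1) := by
        rw [Finset.sum_mul]
        exact Finset.sum_congr rfl fun S _ => by ring
    _ ≤ ∑ S : T, K S.1 * Nat.card (F i) ^ r := by
        refine Finset.sum_le_sum fun S _ => ?_
        gcongr
        exact S.2
    _ = _ := by rw [Finset.sum_mul]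

end

theorem eventually_le_card {L : FirstOrder.Language} {M : Type*} [L.Structure M] [Infinite M]
    {ι : Type*} {U : Ultrafilter ι} {F : ι → Type*} [∀ i, L.Structure (F i)]
    [∀ i, Nonempty (F i)] [∀ i, Finite (F i)] (h_psf : M ≅[L] (U : Filter ι).Product F) (N : ℕ) :
    ∀ᶠ i in U, N ≤ Nat.card (F i) := by
  let φ : L.Formula (Fin N) := Formula.iInf fun p : {p : Fin N × Fin N // p.1 ≠ p.2} =>
    ((Term.var p.1.1).equal (Term.var p.1.2)).not
  have h : ∃ v : Fin N → M, φ.Realize v := by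
    refine ⟨fun j => Infinite.natEmbedding M j, ?_⟩
    simp only [φ, Formula.realize_iInf, Formula.realize_not, Formula.realize_equal,
      Term.realize_var]
    rintro ⟨⟨j, j'⟩, hj⟩ e
    exact hj (Fin.ext ((Infinite.natEmbedding M).injective e))
  refine (transfer_exists h_psf h).mono fun i ⟨v, hv⟩ => ?_
  simp only [φ, Formula.realize_iInf, Formula.realize_not, Formula.realize_equal,
    Term.realize_var] at hv
  have : Function.Injective v := fun j j' e => by
    by_contra hj
    exact hv ⟨(j, j'), hj⟩ e
  simpa using Nat.card_le_card_of_injective v this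

open scoped Classical in
-- `K` depends only on `R` and is chosen before `m`; this is what allows `m` to tend to infinity
-- afterwards.
theorem IsGeneric.exists_pow_le {L : FirstOrder.Language} [Fintype (Σ n, L.Relations n)]
    [IsEmpty (L.Relations 0)] [L.IsRelational] {f : ℝ → ℝ} {M : Type*} [L.Structure M]
    (hM : IsGeneric L f M) (hf : Tendsto f atTop atTop) (R : L.Relations 3)
    (hf_mono : MonotoneOn f (Set.Ici 0))
    (hf_double : ∀ a : ℝ, 0 ≤ a → f (2 * a + 1) ≤ f a + 1)
    {ι : Type*} {U : Ultrafilter ι} {F : ι → Type*} [∀ i, L.Structure (F i)]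
    [∀ i, Nonempty (F i)] [∀ i, Finite (F i)] (h_psf : M ≅[L] (U : Filter ι).Product F)
    {n k : ℕ} (Φ : L.Formula (Fin n)) {a : Fin n → M} (ha : Φ.Realize a)
    (hk : setDim L (Finset.univ.image a) = k) :
    ∃ K : ℕ, ∀ m : ℕ, ∀ᶠ i in U, Nat.card (F i) ^ (m * k) ≤
      2 * (Nat.card (F i) * ({v : Fin n → F i | Φ.Realize v}.ncard * K ^ k) ^ m) := by
  have hadm := hM.admissible
  have hinf : Infinite M := hM.infinite R hf_mono hf_double
  obtain ⟨K, hK⟩ := hadm.exists_relMap_fiber hf R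
  refine ⟨K, fun m => ?_⟩
  obtain ⟨S, -, hS, hSe⟩ := hadm.exists_basis a hf Finset.univ
  have hSk : S.card = k := by omega
  let s : Fin k → Fin n := fun j => S.equivFin.symm (Fin.cast hSk.symm j)
  have hs : Indep L (a ∘ s) := by
    refine hadm.indep_of_card_le_setDim ?_
    rw [Fintype.card_fin, ← hk, ← hSe]
    refine hadm.setDim_mono fun x hx => ?_
    obtain ⟨i, hi, rfl⟩ := Finset.mem_image.1 hx
    refine Finset.mem_image.2 ⟨Fin.cast hSk (S.equivFin ⟨i, hi⟩), Finset.mem_univ _, ?_⟩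
    simp [s]
  -- `χ` defines the families of less than full dimension. The subtraction is in `ℤ`, so for `m * k
  -- = 0` no family satisfies `χ`.
  obtain ⟨χ, hχ⟩ := Set.empty_definable_iff.1
    (hadm.definable_setDim_le hf (γ := Fin m × Fin k) (((m * k : ℕ) : ℤ) - 1))
  replace hχ : ∀ y : Fin m × Fin k → M, χ.Realize y ↔
      setDim L (Finset.univ.image y) ≤ ((m * k : ℕ) : ℤ) - 1 := fun y =>
    (Set.ext_iff.1 hχ y).symm
  obtain ⟨C, hC⟩ := hadm.exists_ncard_mul_le hf h_psf (Φ := χ) (r := m * k) fun y hy => by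
    have := (hχ y).1 hy
    omega
  let V := Unit ⊕ Fin m × Fin n
  let θ : L.Formula ((Fin m × Fin k) ⊕ V) :=
    Formula.iInf (fun i : Fin m => Φ.relabel fun j => Sum.inr (Sum.inr (i, j))) ⊓
    Formula.iInf (fun p : Fin m × Fin k => R.formula fun l =>
      Term.var (![Sum.inr (Sum.inl ()), Sum.inl p, Sum.inr (Sum.inr (p.1, s p.2))] l))
  have hθ : ∀ y : Fin m × Fin k → M, (χ ⊔ θ.iExs V).Realize y := by
    intro y
    rw [Formula.realize_sup, Formula.realize_iExs]
    by_cases hy : χ.Realize y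
    · exact Or.inl hy
    right
    rw [hχ] at hy
    have hyi : Indep L y := hadm.indep_of_card_le_setDim (by
      rw [Fintype.card_prod, Fintype.card_fin, Fintype.card_fin]
      omega)
    obtain ⟨x, b, hb, hR⟩ := hM.exists_common_point hf R hf_mono hf_double Φ ha hs hyi
    refine ⟨Sum.elim (fun _ => x) fun p => b p.1 p.2, ?_⟩
    simp only [θ, Formula.realize_inf, Formula.realize_iInf, Formula.realize_relabel,
      Formula.realize_rel, Term.realize_var]
    refine ⟨hb, fun p => ?_⟩
    convert hR p.1 p.2 with l
    fin_cases l <;> rfl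
  filter_upwards [transfer_forall h_psf hθ, hC, eventually_le_card h_psf (2 * C),
    transfer_fiber h_psf hK] with i hi1 hi2 hi3 hi4
  refine pow_le_of_common_point (Q := fun x y z => RelMap R ![x, y, z]) (s := s)
    (bad := {y | χ.Realize y}) (fun x z => ?_) hi2 hi3 fun y hy => ?_
  · refine le_trans ?_ (hi4 ![x, z])
    rw [← Set.ncard_image_of_injective (f := fun y => ![x, y, z]) _
      fun y y' e => congrFun e 1]
    refine Set.ncard_le_ncard ?_
    rintro _ ⟨y, hy, rfl⟩
    refine ⟨?_, ?_⟩
    · rw [Formula.realize_rel]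
      exact hy
    · funext l
      fin_cases l <;> rfl
  · have h1 := hi1 y
    rw [Formula.realize_sup, Formula.realize_iExs] at h1
    obtain ⟨w, hw⟩ := h1.resolve_left hy
    simp only [θ, Formula.realize_inf, Formula.realize_iInf, Formula.realize_relabel,
      Formula.realize_rel, Term.realize_var] at hw
    refine ⟨w (Sum.inl ()), fun i j => w (Sum.inr (i, j)), hw.1, fun i j => ?_⟩
    convert hw.2 (i, j) with l
    fin_cases l <;> rfl

/-! ### Passing to logarithms and to the limit -/

theorem logRatio_eq_coe {L : FirstOrder.Language} {F : Type*} [L.Structure F] {n : ℕ}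
    {Φ : L.Formula (Fin n)} (hN : Nat.card F ≠ 0) (hc : {v : Fin n → F | Φ.Realize v}.ncard ≠ 0) :
    logRatio F Φ = ((Real.log {v : Fin n → F | Φ.Realize v}.ncard /
      Real.log (Nat.card F) : ℝ) : EReal) := by
  have key : ∀ c : ℕ, c ≠ 0 → ENNReal.log (c : ENNReal) = ((Real.log c : ℝ) : EReal) := by
    intro c hc
    rw [ENNReal.log_pos_real (by exact_mod_cast hc) (ENNReal.natCast_ne_top c),
      ENNReal.toReal_natCast]
  rw [logRatio, EReal.coe_div, key _ hN, ← key _ hc]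
  rfl

theorem logRatio_eq_bot {L : FirstOrder.Language} {F : Type*} [L.Structure F] {n : ℕ}
    {Φ : L.Formula (Fin n)} (hN : 2 ≤ Nat.card F)
    (hc : {v : Fin n → F | Φ.Realize v}.ncard = 0) : logRatio F Φ = ⊥ := by
  have h0 : Nat.card {v : Fin n → F // Φ.Realize v} = 0 := hc
  rw [logRatio, h0, Nat.cast_zero, ENNReal.log_zero]
  refine EReal.bot_div_of_pos_ne_top ?_ ?_
  · rw [ENNReal.zero_lt_log_iff]
    exact_mod_cast hN
  · rw [Ne, ENNReal.log_eq_top_iff]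
    exact ENNReal.natCast_ne_top _

section

variable {L : FirstOrder.Language} {M : Type*} [L.Structure M] [Infinite M]
    {ι : Type*} {U : Ultrafilter ι} {F : ι → Type*} [∀ i, L.Structure (F i)]
    [∀ i, Nonempty (F i)] [∀ i, Finite (F i)] (h_psf : M ≅[L] (U : Filter ι).Product F)

include h_psf

theorem tendsto_log_card : Tendsto (fun i => Real.log (Nat.card (F i))) U atTop := by
  refine Real.tendsto_log_atTop.comp (tendsto_natCast_atTop_atTop.comp (tendsto_atTop.2 fun N => ?_))
  exact eventually_le_card h_psf N

theorem tendsto_add_div_log_card (a b : ℝ) :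
    Tendsto (fun i => ((a + b / Real.log (Nat.card (F i)) : ℝ) : EReal)) U (𝓝 (a : EReal)) := by
  refine (continuous_coe_real_ereal.tendsto a).comp ?_
  simpa using ((tendsto_log_card h_psf).const_div_atTop b).const_add a

variable {n : ℕ} {Φ : L.Formula (Fin n)} {k : ℕ}

theorem coarseDim_eq_bot (h : ∀ v : Fin n → M, ¬ Φ.Realize v) : coarseDim U F Φ = ⊥ := by
  refine tendsto_nhds_unique (tendsto_coarseDim U F Φ) (tendsto_const_nhds.congr' ?_)
  filter_upwards [transfer_forall (φ := Φ.not) h_psf (by simpa using h),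
    eventually_le_card h_psf 2] with i hi hN
  refine (logRatio_eq_bot hN ?_).symm
  rw [Set.ncard_eq_zero]
  ext v
  simpa using hi v

theorem coarseDim_le_of_eventually_le {C : ℕ} (h : ∀ᶠ i in U,
    {v : Fin n → F i | Φ.Realize v}.ncard * Nat.card (F i) ≤ C * Nat.card (F i) ^ (k + 1)) :
    coarseDim U F Φ ≤ ((k : ℝ) : EReal) := by
  refine le_of_tendsto_of_tendsto (tendsto_coarseDim U F Φ)
    (tendsto_add_div_log_card h_psf k (Real.log C)) ?_
  filter_upwards [h, eventually_le_card h_psf 2] with i hi hN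
  by_cases hc : {v : Fin n → F i | Φ.Realize v}.ncard = 0
  · rw [logRatio_eq_bot hN hc]
    exact bot_le
  rw [logRatio_eq_coe (by omega) hc, EReal.coe_le_coe_iff]
  set c := {v : Fin n → F i | Φ.Realize v}.ncard
  set N := Nat.card (F i)
  have h1 : c ≤ C * N ^ k := by
    refine Nat.le_of_mul_le_mul_right (c := N) ?_ (by omega)
    calc c * N ≤ C * N ^ (k + 1) := hi
      _ = _ := by ring
  have hC : C ≠ 0 := by
    rintro rfl
    simp at h1
    exact hc h1
  have hlog : 0 < Real.log N := Real.log_pos (by exact_mod_cast hN)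
  have h2 : Real.log c ≤ Real.log C + k * Real.log N := by
    rw [← Real.log_pow, ← Real.log_mul (by exact_mod_cast hC) (by positivity)]
    refine Real.log_le_log (by exact_mod_cast Nat.pos_of_ne_zero hc) ?_
    exact_mod_cast h1
  rw [div_le_iff₀ hlog, add_mul, div_mul_cancel₀ _ hlog.ne']
  linarith

/-- Dividing the logarithm of the inequality by `m * log |F|` leaves a loss of `1 / m` from the
single factor `|F|`; the constants vanish along `U`. -/
theorem le_coarseDim_of_eventually_le {K : ℕ} (h : ∀ m : ℕ, ∀ᶠ i in U,
    Nat.card (F i) ^ (m * k) ≤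
      2 * (Nat.card (F i) * ({v : Fin n → F i | Φ.Realize v}.ncard * K ^ k) ^ m)) :
    ((k : ℝ) : EReal) ≤ coarseDim U F Φ := by
  have key : ∀ m : ℕ, (((k : ℝ) - 1 / ((m : ℝ) + 1) : ℝ) : EReal) ≤ coarseDim U F Φ := by
    intro m
    -- The hypothesis is used at `m + 1`, to divide by a positive number, and `K` is weakened to `K
    -- + 1`, to take the logarithm of a nonzero number.
    refine le_of_tendsto_of_tendsto (tendsto_add_div_log_card h_psf _
      (-(Real.log 2 / (m + 1) + k * Real.log (K + 1)))) (tendsto_coarseDim U F Φ) ?_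
    filter_upwards [h (m + 1), eventually_le_card h_psf 2] with i hi hN
    have hN0 : 0 < Nat.card (F i) := by omega
    have hc : {v : Fin n → F i | Φ.Realize v}.ncard ≠ 0 := by
      intro hc
      rw [hc] at hi
      simp at hi
      omega
    rw [logRatio_eq_coe (by omega) hc, EReal.coe_le_coe_iff]
    set c := {v : Fin n → F i | Φ.Realize v}.ncard
    set N := Nat.card (F i)
    have hlog : 0 < Real.log N := Real.log_pos (by exact_mod_cast hN)
    have h1 : N ^ ((m + 1) * k) ≤ 2 * (N * (c * (K + 1) ^ k) ^ (m + 1)) := by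
      refine hi.trans ?_
      gcongr
      omega
    have hc' : (c : ℝ) ≠ 0 := by exact_mod_cast hc
    have hN' : (N : ℝ) ≠ 0 := by exact_mod_cast hN0.ne'
    have hK' : ((K : ℝ) + 1) ≠ 0 := by positivity
    have h2 : (N : ℝ) ^ ((m + 1) * k) ≤ 2 * (N * (c * (K + 1) ^ k) ^ (m + 1)) := by
      exact_mod_cast h1
    have h3 := Real.log_le_log (by positivity) h2
    rw [Real.log_mul (by norm_num) (by positivity), Real.log_mul hN' (by positivity),
      Real.log_pow, Real.log_pow, Real.log_mul hc' (by positivity), Real.log_pow] at h3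
    push_cast at h3
    have hm : (0 : ℝ) < m + 1 := by positivity
    rw [le_div_iff₀ hlog, add_mul, div_mul_cancel₀ _ hlog.ne']
    refine le_of_mul_le_mul_left ?_ hm
    have e : ((m : ℝ) + 1) * (((k : ℝ) - 1 / (m + 1)) * Real.log N +
        -(Real.log 2 / (m + 1) + k * Real.log (K + 1))) =
        (m + 1) * k * Real.log N - Real.log N - Real.log 2 -
          (m + 1) * (k * Real.log (K + 1)) := by
      field_simp
      ring
    rw [e]
    linarith
  refine le_of_tendsto' (f := fun m : ℕ => (((k : ℝ) - 1 / ((m : ℝ) + 1) : ℝ) : EReal))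
    (x := atTop) ?_ key
  refine (continuous_coe_real_ereal.tendsto _).comp ?_
  simpa using tendsto_one_div_add_atTop_nhds_zero_nat.const_sub (k : ℝ)

end

end HrushovskiGeneric

theorem mainTheorem6 {L : FirstOrder.Language} [L.IsRelational] [Fintype (Σ n, L.Relations n)]
    (h_arity : IsEmpty (L.Relations 0)) (h_ternary : Nonempty (L.Relations 3))
    (f f' : ℝ → ℝ) (hf_cont : ContinuousOn f (Set.Ici 0)) (hf_mono : MonotoneOn f (Set.Ici 0))
    (hf_top : Tendsto f atTop atTop)
    (hf_deriv : ∀ x, 0 ≤ x → HasDerivWithinAt f (f' x) (Set.Ici x) x)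
    (hf_bound : ∀ x, 0 ≤ x → f' x ≤ 1 / (2 * (x + 1)))
    (M : Type*) [L.Structure M] (hM : HrushovskiGeneric.IsGeneric L f M)
    {ι : Type*} (U : Ultrafilter ι) (F : ι → Type*) [∀ i, L.Structure (F i)]
    [∀ i, Finite (F i)] [∀ i, Nonempty (F i)]
    (h_psf : M ≅[L] (U : Filter ι).Product F)
    {n : ℕ} (Φ : L.Formula (Fin n)) :
    HrushovskiGeneric.coarseDim U F Φ = HrushovskiGeneric.formulaDim M Φ := by
  classical
  obtain ⟨R⟩ := h_ternary
  have hf_double : ∀ a : ℝ, 0 ≤ a → f (2 * a + 1) ≤ f a + 1 := fun a ha =>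
    HrushovskiGeneric.apply_two_mul_add_one_le hf_cont hf_deriv hf_bound ha
  have hadm := hM.admissible
  have hinf : Infinite M := hM.infinite R hf_mono hf_double
  refine le_antisymm ?_ (iSup_le ?_)
  · by_cases hΦ : ∃ a : Fin n → M, Φ.Realize a
    -- The dimension of an `n`-tuple is at most `n`, so the supremum is attained.
    · obtain ⟨r, ⟨a, ha, hr⟩, hmax⟩ := Int.exists_greatest_of_bdd
        (P := fun z => ∃ a : Fin n → M, Φ.Realize a ∧ HrushovskiGeneric.tupleDim L a = z)
        ⟨n, by
          rintro _ ⟨a, -, rfl⟩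
          rw [HrushovskiGeneric.tupleDim_eq]
          refine (hadm.setDim_le subset_rfl).trans
            ((HrushovskiGeneric.predim_le_card _).trans ?_)
          exact_mod_cast Finset.card_image_le.trans_eq (by simp)⟩
        (hΦ.elim fun a ha => ⟨_, a, ha, rfl⟩)
      rw [HrushovskiGeneric.tupleDim_eq] at hr
      lift r to ℕ using hr ▸ hadm.setDim_nonneg _ with k
      obtain ⟨C, hC⟩ := hadm.exists_ncard_mul_le hf_top h_psf (Φ := Φ) (r := k + 1) fun b hb => by
        have := hmax _ ⟨b, hb, rfl⟩
        rw [HrushovskiGeneric.tupleDim_eq] at this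
        push_cast
        omega
      refine (HrushovskiGeneric.coarseDim_le_of_eventually_le h_psf hC).trans
        (le_iSup_of_le ⟨a, ha⟩ ?_)
      rw [HrushovskiGeneric.tupleDim_eq, hr, Int.cast_natCast]
    · push Not at hΦ
      rw [HrushovskiGeneric.coarseDim_eq_bot h_psf hΦ]
      exact bot_le
  · rintro ⟨a, ha⟩
    rw [HrushovskiGeneric.tupleDim_eq]
    obtain ⟨k, hk⟩ := Int.eq_ofNat_of_zero_le (hadm.setDim_nonneg (Finset.univ.image a))
    obtain ⟨K, hK⟩ := hM.exists_pow_le hf_top R hf_mono hf_double h_psf Φ ha hk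
    rw [hk, Int.cast_natCast]
    exact HrushovskiGeneric.le_coarseDim_of_eventually_le h_psf hK
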